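/- There is a non-empty compact separable Hausdorff space $Z'$ with all of the following properties: (i) $Z'$ is nice; (ii) no subspace of $Z'$ is homeomorphic to the Cantor set; (iii) no non-empty open subset $W \subseteq Z'$ is an ordered space (LOTS), that is, the relative topology of $W$ is not the order topology of any linear order on $W$; (iv) $Z'$ has the Complex Stone--Weierstrass Property (CSWP); (v) $Z'$ is not LPR-scattered. Here, for a compact Hausdorff space $X$, let $C(X)$ be the algebra of continuous complex-valued functions on $X$ with the supremum norm. A topological space is scattered if each of its non-empty subsets has an isolated point. $X$ is nice if there is a countable $\mathcal E \subseteq C(X)$ such that, writing $x \sim y$ iff $f(x)=f(y)$ for all $f\in\mathcal E$ and $[x]$ for the equivalence class of $x$, (1) every class $[x]$ is scattered, and (2) for every $f \in C(X)$, $f([x])$ is a singleton for all but at most countably many classes $[x]$. $X$ has the CSWP if every subalgebra of $C(X)$ that contains the constant functions and separates the points of $X$ is dense in $C(X)$. A compact Hausdorff space $H$ is LPR if it has no subspace homeomorphic to the Cantor set and, for every regular complex Borel measure $\mu$ on $H$, the support of $|\mu|$ is homeomorphic to a compact separable LOTS (a linearly ordered set with its order topology). $X$ is LPR-scattered if every non-empty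 closed $F\subseteq X$ has a non-empty subset $U$, relatively open in $F$, whose closure is LPR. -/

import Mathlib

open Set Topology MeasureTheory

universe u

/-- `X` is a LOTS (an ordered space): its topology is the order topology of some linear order. -/
def IsLOTS (X : Type u) [TopologicalSpace X] : Prop :=
  ∃ _ : LinearOrder X, OrderTopology X

/-- `X` contains a Cantor set: some subspace of `X` is homeomorphic to `2 ^ ℕ`. -/
def HasCantorSubset (X : Type u) [TopologicalSpace X] : Prop :=
  ∃ K : Set X, Nonempty (K ≃ₜ (ℕ → Bool))

/-- The set `S` is scattered in its relative topology: every non-empty subset of `S` has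
an isolated point. -/
def IsScatteredSet {X : Type u} [TopologicalSpace X] (S : Set X) : Prop :=
  ∀ T : Set X, T ⊆ S → T.Nonempty → ∃ x ∈ T, ∃ U : Set X, IsOpen U ∧ U ∩ T = {x}

/-- The Complex Stone-Weierstrass Property of the compact space `X`: every subalgebra of
`C(X, ℂ)` that separates points (and contains the constants) is dense. -/
def HasCSWP (X : Type u) [TopologicalSpace X] : Prop :=
  ∀ A : Subalgebra ℂ C(X, ℂ), A.SeparatesPoints → Dense (A : Set C(X, ℂ))

/-- The relation `x ∼ y` iff `f x = f y` for all `f ∈ E`. -/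
def evalSetoid {X : Type u} [TopologicalSpace X] (E : Set C(X, ℂ)) : Setoid X where
  r x y := ∀ f ∈ E, f x = f y
  iseqv :=
    { refl := fun _ _ _ => rfl
      symm := fun h f hf => (h f hf).symm
      trans := fun h h' f hf => (h f hf).trans (h' f hf) }

/-- The family `E` of continuous functions is nice: all classes `[x]` are scattered, and every
`f ∈ C(X, ℂ)` maps all but countably many classes to singletons. -/
def IsNiceFamily {X : Type u} [TopologicalSpace X] (E : Set C(X, ℂ)) : Prop :=
  (∀ c ∈ (evalSetoid E).classes, IsScatteredSet c) ∧
    ∀ f : C(X, ℂ), {c ∈ (evalSetoid E).classes | ¬ ∃ w : ℂ, f '' c = {w}}.Countable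

/-- The compact space `X` is nice. -/
def IsNiceSpace (X : Type u) [TopologicalSpace X] : Prop :=
  ∃ E : Set C(X, ℂ), E.Countable ∧ IsNiceFamily E

/-- `H` is LPR: a compact Hausdorff space without a Cantor subset in which the support of
(the total variation of) every regular complex Borel measure is a compact separable LOTS. -/
def IsLPR (H : Type u) [TopologicalSpace H] : Prop :=
  CompactSpace H ∧ T2Space H ∧ ¬ HasCantorSubset H ∧
    ∀ (_ : MeasurableSpace H) (_ : BorelSpace H) (μ : ComplexMeasure H),
      μ.variation.Regular →
        IsCompact μ.variation.support ∧
          TopologicalSpace.SeparableSpace μ.variation.support ∧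
          IsLOTS μ.variation.support

/-- `X` is scattered for the class of LPR spaces: every non-empty closed `F ⊆ X` has a
non-empty relatively open subset `U` whose closure is LPR. -/
def IsLPRScattered (X : Type u) [TopologicalSpace X] : Prop :=
  ∀ F : Set X, IsClosed F → F.Nonempty →
    ∃ U : Set X, U ⊆ F ∧ U.Nonempty ∧ (∃ V : Set X, IsOpen V ∧ U = V ∩ F) ∧
      IsLPR (closure U)

/-! Split every point x of the Cantor set into three points: one approached from the lexicographic
left, two approached from the right, according to the parity of the index where the approaching
sequence first leaves x. The space is the closure, in this compact splitting, of the countable set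
of left points over eventually true sequences; hence it is separable.

The positive properties hold for every compact Hausdorff space with a `SplitMap`. Fibres over the
Cantor set are finite, and a continuous function oscillates by ε on only finitely many of them, so
the space is nice. For a closed Y, all but countably many points of the image of Y are two-sided,
and each of them defines its own clopen cut of Y. So a Cantor set, having countably many clopen
sets, cannot embed. For the CSWP, `hasCSWP_of_gapFunction` reduces the question to finding, on a
minimal boundary, a function of the algebra with values near 0 and 1 only. `SplitMap.hasGapFunction`
finds it by the Baire theorem: uniformly controlled jumps at two nearby two-sided points, multiplied
by a peak function, imitate the indicator of an interval.

The negative properties come from one obstruction. Sequences that differ first at even indices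
cannot see each other on the odd right side, so their odd right points form a discrete set; every
non-empty open set contains an uncountable one. Separable ordered spaces, and hence separable LPR
spaces, have none. -/

/-! ### Discrete subsets of separable ordered spaces and of separable LPR spaces. -/

/-- A separable ordered space has no uncountable relatively discrete subset. -/
theorem IsLOTS.countable_of_discrete {Y : Type u} [TopologicalSpace Y]
    [TopologicalSpace.SeparableSpace Y] (hY : IsLOTS Y) {D : Set Y}
    (hD : ∀ d ∈ D, ∃ U : Set Y, IsOpen U ∧ U ∩ D = {d}) : D.Countable := by
  obtain ⟨_, _⟩ := hY
  -- The witnessing intervals of distinct points of `L` are disjoint non-empty open sets, so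
  -- separability bounds `L`; likewise `R`. A point of `D` outside both that is not an endpoint of
  -- the order is isolated in `Y`.
  set L : Set Y := {d ∈ D | ∃ a < d, (Ioo a d).Nonempty ∧ Ioc a d ∩ D ⊆ {d}} with hL
  set R : Set Y := {d ∈ D | ∃ b > d, (Ioo d b).Nonempty ∧ Ico d b ∩ D ⊆ {d}} with hR
  have hLc : L.Countable := by
    choose! a ha using fun d (hd : d ∈ L) => hd.2
    refine PairwiseDisjoint.countable_of_isOpen (s := fun d => Ioo (a d) d) ?_
      (fun d _ => isOpen_Ioo) fun d hd => (ha d hd).2.1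
    have key : ∀ d ∈ L, ∀ e ∈ L, d < e → Disjoint (Ioo (a d) d) (Ioo (a e) e) := by
      intro d hd e he hde
      rw [Set.disjoint_left]
      rintro x ⟨_, hxd⟩ ⟨hxe, _⟩
      exact hde.ne ((ha e he).2.2 ⟨⟨hxe.trans hxd, hde.le⟩, hd.1⟩)
    intro d hd e he hne
    rcases lt_or_gt_of_ne hne with h | h
    · exact key d hd e he h
    · exact (key e he d hd h).symm
  have hRc : R.Countable := by
    choose! b hb using fun d (hd : d ∈ R) => hd.2
    refine PairwiseDisjoint.countable_of_isOpen (s := fun d => Ioo d (b d)) ?_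
      (fun d _ => isOpen_Ioo) fun d hd => (hb d hd).2.1
    have key : ∀ d ∈ R, ∀ e ∈ R, d < e → Disjoint (Ioo d (b d)) (Ioo e (b e)) := by
      intro d hd e he hde
      rw [Set.disjoint_left]
      rintro x ⟨_, hxd⟩ ⟨hxe, _⟩
      exact hde.ne' ((hb d hd).2.2 ⟨⟨hde.le, hxe.trans hxd⟩, he.1⟩)
    intro d hd e he hne
    rcases lt_or_gt_of_ne hne with h | h
    · exact key d hd e he h
    · exact (key e he d hd h).symm
  have hI : {d : Y | IsOpen ({d} : Set Y)}.Countable := by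
    refine PairwiseDisjoint.countable_of_isOpen (s := fun d => ({d} : Set Y)) ?_
      (fun d hd => hd) fun d _ => singleton_nonempty d
    intro d _ e _ hne
    simpa [Function.onFun] using hne
  have hB : {d : Y | IsBot d}.Countable := subsingleton_isBot Y |>.countable
  have hT : {d : Y | IsTop d}.Countable := subsingleton_isTop Y |>.countable
  refine (hLc.union (hRc.union (hI.union (hB.union hT)))).mono fun d hd => ?_
  by_contra hcon
  simp only [mem_union, mem_ofPred_eq, not_or, IsBot, IsTop, not_forall, not_le] at hcon
  obtain ⟨h1, h2, h3, ⟨a0, ha0⟩, ⟨b0, hb0⟩⟩ := hcon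
  obtain ⟨U, hU, hUD⟩ := hD d hd
  have hdU : d ∈ U := (hUD.ge rfl).1
  obtain ⟨a, b, hab, hsub⟩ := (mem_nhds_iff_exists_Ioo_subset' ⟨a0, ha0⟩ ⟨b0, hb0⟩).1
    (hU.mem_nhds hdU)
  have e1 : Ioo a d = ∅ := by
    rw [← not_nonempty_iff_eq_empty]
    intro hne
    exact h1 ⟨hd, a, hab.1, hne, fun x hx => hUD.le
      ⟨hsub ⟨hx.1.1, hx.1.2.trans_lt hab.2⟩, hx.2⟩⟩
  have e2 : Ioo d b = ∅ := by
    rw [← not_nonempty_iff_eq_empty]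
    intro hne
    exact h2 ⟨hd, b, hab.2, hne, fun x hx => hUD.le
      ⟨hsub ⟨hab.1.trans_le hx.1.1, hx.1.2⟩, hx.2⟩⟩
  apply h3
  have : ({d} : Set Y) = Ioo a b := by
    ext x
    constructor
    · rintro rfl; exact hab
    · intro hx
      rcases lt_trichotomy x d with h | h | h
      · exact absurd (show x ∈ Ioo a d from ⟨hx.1, h⟩) (by simp [e1])
      · exact h
      · exact absurd (show x ∈ Ioo d b from ⟨h, hx.2⟩) (by simp [e2])
  rw [this]
  exact isOpen_Ioo

/-- A separable compact Hausdorff space carries a regular complex measure of full support. -/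
theorem exists_complexMeasure_support_eq_univ (H : Type u) [TopologicalSpace H] [T2Space H]
    [CompactSpace H] [TopologicalSpace.SeparableSpace H] [Nonempty H]
    [MeasurableSpace H] [BorelSpace H] :
    ∃ μ : ComplexMeasure H, μ.variation.Regular ∧ μ.variation.support = univ := by
  -- The measure is the image, along a dense sequence, of a finite measure that charges every
  -- integer.
  obtain ⟨d, hd⟩ := TopologicalSpace.exists_dense_seq H
  obtain ⟨κ, hκ, hpos⟩ : ∃ κ : Measure ℕ, IsFiniteMeasure κ ∧ ∀ n, 0 < κ {n} := by
    obtain ⟨κ, hκ, hac, -⟩ := exists_isFiniteMeasure_absolutelyContinuous (Measure.count (α := ℕ))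
    exact ⟨κ, hκ, fun n => pos_iff_ne_zero.2 fun h => by simpa using hac h⟩
  have hκr : κ.InnerRegular := inferInstance
  have hm : Measurable d := measurable_from_nat
  set ν := κ.map d with hν
  have hfin : IsFiniteMeasure ν := inferInstance
  have hreg : ν.InnerRegular := Measure.InnerRegular.map_of_continuous continuous_of_discreteTopology
  have hreg' : ν.Regular := inferInstance
  let μ : ComplexMeasure H := ν.toSignedMeasure.mapRange
    (Complex.ofRealHom : ℝ →+ ℂ) Complex.continuous_ofReal
  have happ : ∀ E, MeasurableSet E → ‖μ E‖ₑ = ν E := by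
    intro E hE
    have : μ E = ((ν.real E : ℝ) : ℂ) := by
      rw [← Measure.toSignedMeasure_apply_measurable hE]
      rfl
    rw [this, ← ofReal_norm, Complex.norm_real, Real.norm_of_nonneg measureReal_nonneg,
      ofReal_measureReal]
  have hvar : μ.variation = ν := by
    refine le_antisymm (VectorMeasure.variation_le_of_forall_enorm_le fun E hE => (happ E hE).le) ?_
    refine Measure.le_iff.2 fun E hE => ?_
    rw [← happ E hE]
    exact VectorMeasure.enorm_measure_le_variation _ _
  refine ⟨μ, hvar ▸ hreg', ?_⟩
  rw [hvar, eq_univ_iff_forall]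
  intro x
  rw [Measure.mem_support_iff_forall]
  intro U hU
  obtain ⟨n, hn⟩ := hd.exists_mem_open isOpen_interior ⟨x, mem_interior_iff_mem_nhds.2 hU⟩
  calc 0 < κ {n} := hpos n
    _ ≤ κ (d ⁻¹' interior U) := measure_mono (by simpa using hn)
    _ = ν (interior U) := (Measure.map_apply hm isOpen_interior.measurableSet).symm
    _ ≤ ν U := measure_mono interior_subset

theorem isOpen_inter_preimage_val_eq_singleton {X : Type u} [TopologicalSpace X] {S D : Set X}
    (hD : ∀ d ∈ D, ∃ U : Set X, IsOpen U ∧ U ∩ D = {d}) :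
    ∀ d ∈ (Subtype.val : S → X) ⁻¹' D, ∃ U : Set S, IsOpen U ∧
      U ∩ Subtype.val ⁻¹' D = {d} := by
  intro d hd
  obtain ⟨U, hU, hUD⟩ := hD d hd
  refine ⟨Subtype.val ⁻¹' U, hU.preimage continuous_subtype_val, ?_⟩
  rw [← preimage_inter, hUD]
  ext x
  simp [Subtype.ext_iff]

theorem countable_of_preimage_val {X : Type u} {S D : Set X} (hDS : D ⊆ S)
    (h : ((Subtype.val : S → X) ⁻¹' D).Countable) : D.Countable :=
  (h.image Subtype.val).mono fun x hx => (mem_image _ _ _).2 ⟨⟨x, hDS hx⟩, hx, rfl⟩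

/-- In a separable LPR space every relatively discrete subset is countable. -/
theorem IsLPR.countable_of_discrete {H : Type u} [TopologicalSpace H]
    [TopologicalSpace.SeparableSpace H] (hH : IsLPR H) {D : Set H}
    (hD : ∀ d ∈ D, ∃ U : Set H, IsOpen U ∧ U ∩ D = {d}) : D.Countable := by
  obtain ⟨_, _, _, hμ⟩ := hH
  rcases isEmpty_or_nonempty H with hE | hE
  · exact Set.to_countable D
  let _ : MeasurableSpace H := borel H
  have hb : BorelSpace H := ⟨rfl⟩
  -- Full support turns the condition on supports into a condition on all of `H`.
  obtain ⟨μ, hreg, hsupp⟩ := exists_complexMeasure_support_eq_univ H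
  obtain ⟨-, hsep, hlots⟩ := hμ _ hb μ hreg
  exact countable_of_preimage_val (hsupp ▸ subset_univ D)
    (hlots.countable_of_discrete (isOpen_inter_preimage_val_eq_singleton hD))

/-! ### A polynomial iteration that sharpens values near 0 and 1. -/

/-- The polynomial `3 z ^ 2 - 2 z ^ 3` has superattracting fixed points `0` and `1`. -/
noncomputable def smoothStep (z : ℂ) : ℂ := 3 * z ^ 2 - 2 * z ^ 3

theorem smoothStep_one_sub (z : ℂ) : smoothStep z - 1 = -smoothStep (1 - z) := by
  simp only [smoothStep]; ring

theorem norm_smoothStep_le {z : ℂ} (hz : ‖z‖ ≤ 1 / 4) : ‖smoothStep z‖ ≤ 7 / 8 * ‖z‖ := by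
  have h : smoothStep z = z * (z * (3 - 2 * z)) := by simp only [smoothStep]; ring
  -- For |z| ≤ 1/4 this is at most 7/2, and 1/4 * 7/2 = 7/8.
  have h2 : ‖(3 : ℂ) - 2 * z‖ ≤ 3 + 2 * ‖z‖ := (norm_sub_le _ _).trans (by simp)
  rw [h, norm_mul, norm_mul, mul_comm]
  have h0 := norm_nonneg z
  gcongr
  nlinarith

theorem norm_smoothStep_sub_one_le {z : ℂ} (hz : ‖z - 1‖ ≤ 1 / 4) :
    ‖smoothStep z - 1‖ ≤ 7 / 8 * ‖z - 1‖ := by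
  rw [smoothStep_one_sub, norm_neg, norm_sub_rev z 1]
  exact norm_smoothStep_le (by rwa [norm_sub_rev])

theorem norm_iterate_smoothStep_le {z : ℂ} (hz : ‖z‖ ≤ 1 / 4) (n : ℕ) :
    ‖smoothStep^[n] z‖ ≤ (7 / 8) ^ n := by
  have : ‖smoothStep^[n] z‖ ≤ (7 / 8) ^ n * (1 / 4) := by
    induction n with
    | zero => simpa using hz
    | succ n ih =>
      rw [Function.iterate_succ_apply']
      have h1 : ‖smoothStep^[n] z‖ ≤ 1 / 4 :=
        ih.trans (mul_le_of_le_one_left (by norm_num) (pow_le_one₀ (by norm_num) (by norm_num)))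
      calc _ ≤ 7 / 8 * ‖smoothStep^[n] z‖ := norm_smoothStep_le h1
        _ ≤ 7 / 8 * ((7 / 8) ^ n * (1 / 4)) := by gcongr
        _ = _ := by ring
  exact this.trans (mul_le_of_le_one_right (by positivity) (by norm_num))

theorem norm_iterate_smoothStep_sub_one_le {z : ℂ} (hz : ‖z - 1‖ ≤ 1 / 4) (n : ℕ) :
    ‖smoothStep^[n] z - 1‖ ≤ (7 / 8) ^ n := by
  have : ‖smoothStep^[n] z - 1‖ ≤ (7 / 8) ^ n * (1 / 4) := by
    induction n with
    | zero => simpa using hz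
    | succ n ih =>
      rw [Function.iterate_succ_apply']
      have h1 : ‖smoothStep^[n] z - 1‖ ≤ 1 / 4 :=
        ih.trans (mul_le_of_le_one_left (by norm_num) (pow_le_one₀ (by norm_num) (by norm_num)))
      calc _ ≤ 7 / 8 * ‖smoothStep^[n] z - 1‖ := norm_smoothStep_sub_one_le h1
        _ ≤ 7 / 8 * ((7 / 8) ^ n * (1 / 4)) := by gcongr
        _ = _ := by ring
  exact this.trans (mul_le_of_le_one_right (by positivity) (by norm_num))

/-! ### Reduction of the CSWP to gap functions on minimal boundaries. -/

section Algebra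

variable {X : Type u} [TopologicalSpace X]

/-- `A` contains a function which on `Y` takes only values near `0` and `1`, and both kinds. -/
def HasGapFunction (A : Subalgebra ℂ C(X, ℂ)) (Y : Set X) : Prop :=
  ∃ g ∈ A, (∀ y ∈ Y, ‖g y‖ ≤ 1 / 4 ∨ ‖g y - 1‖ ≤ 1 / 4) ∧ (∃ y ∈ Y, ‖g y‖ ≤ 1 / 4) ∧
    ∃ y ∈ Y, ‖g y - 1‖ ≤ 1 / 4

/-- `Y` is a boundary for `A` on `F`: every function of `A` attains on `Y` its maximum
modulus over `F`. -/
def IsBoundaryFor (A : Subalgebra ℂ C(X, ℂ)) (F Y : Set X) : Prop :=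
  ∀ f ∈ A, ∀ x ∈ F, ∃ y ∈ Y, ‖f x‖ ≤ ‖f y‖

/-- Every relatively open non-empty subset of `Y` contains a point at which some function of
`A` strictly exceeds in modulus all its values outside this subset. -/
def PeaksEverywhere (A : Subalgebra ℂ C(X, ℂ)) (Y : Set X) : Prop :=
  ∀ U : Set X, IsOpen U → (U ∩ Y).Nonempty →
    ∃ f ∈ A, ∃ p ∈ U ∩ Y, ∀ q ∈ Y \ U, ‖f q‖ < ‖f p‖

theorem exists_iterate_smoothStep_mem {A : Subalgebra ℂ C(X, ℂ)} {g : C(X, ℂ)} (hg : g ∈ A)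
    (n : ℕ) : ∃ e ∈ A, ∀ x, e x = smoothStep^[n] (g x) := by
  induction n with
  | zero => exact ⟨g, hg, fun _ => rfl⟩
  | succ n ih =>
    obtain ⟨e, he, hx⟩ := ih
    refine ⟨(3 : ℂ) • e ^ 2 - (2 : ℂ) • e ^ 3, A.sub_mem (A.smul_mem (A.pow_mem he 2) _)
      (A.smul_mem (A.pow_mem he 3) _), fun x => ?_⟩
    rw [Function.iterate_succ_apply', ← hx x]
    simp [smoothStep]

/-- From a gap function one gets approximate idempotents. -/
theorem HasGapFunction.exists_approx_idempotent {A : Subalgebra ℂ C(X, ℂ)} {Y : Set X}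
    (h : HasGapFunction A Y) {δ : ℝ} (hδ : 0 < δ) :
    ∃ e ∈ A, (∀ y ∈ Y, ‖e y‖ ≤ δ ∨ ‖e y - 1‖ ≤ δ) ∧ (∃ y ∈ Y, ‖e y‖ ≤ δ) ∧
      ∃ y ∈ Y, ‖e y - 1‖ ≤ δ := by
  obtain ⟨g, hg, h1, ⟨y, hy, hy0⟩, ⟨z, hz, hz1⟩⟩ := h
  obtain ⟨n, hn⟩ := exists_pow_lt_of_lt_one hδ (by norm_num : (7 / 8 : ℝ) < 1)
  obtain ⟨e, he, hex⟩ := exists_iterate_smoothStep_mem hg n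
  refine ⟨e, he, fun y hy => ?_, ⟨y, hy, ?_⟩, ⟨z, hz, ?_⟩⟩
  · rw [hex]
    exact (h1 y hy).imp (fun h => (norm_iterate_smoothStep_le h n).trans hn.le)
      fun h => (norm_iterate_smoothStep_sub_one_le h n).trans hn.le
  · rw [hex]
    exact (norm_iterate_smoothStep_le hy0 n).trans hn.le
  · rw [hex]
    exact (norm_iterate_smoothStep_sub_one_le hz1 n).trans hn.le

/-- Gap functions pass from a boundary to the whole set. -/
theorem HasGapFunction.of_boundary {A : Subalgebra ℂ C(X, ℂ)} {F Y : Set X}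
    (h : HasGapFunction A Y) (hYF : Y ⊆ F) (hb : IsBoundaryFor A F Y) : HasGapFunction A F := by
  obtain ⟨e, he, h1, ⟨y, hy, hy0⟩, ⟨z, hz, hz1⟩⟩ :=
    h.exists_approx_idempotent (δ := 1 / 64) (by norm_num)
  refine ⟨e, he, fun x hx => ?_, ⟨y, hYF hy, hy0.trans (by norm_num)⟩,
    ⟨z, hYF hz, hz1.trans (by norm_num)⟩⟩
  -- The product e (e - 1) is at most 1/32 on `Y`, hence on `F`; a value farther than 1/4 from both
  -- 0 and 1 would make it exceed 1/16.
  obtain ⟨w, hw, hxw⟩ := hb (e * (e - 1)) (A.mul_mem he (A.sub_mem he A.one_mem)) x hx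
  simp only [ContinuousMap.mul_apply, ContinuousMap.sub_apply, ContinuousMap.one_apply,
    norm_mul] at hxw
  have hw' : ‖e w‖ * ‖e w - 1‖ ≤ 1 / 32 := by
    have a1 : ‖e w - 1‖ ≤ ‖e w‖ + 1 := (norm_sub_le _ _).trans (by simp)
    have a2 : ‖e w‖ ≤ ‖e w - 1‖ + 1 := by
      simpa using norm_add_le (e w - 1) 1
    have := norm_nonneg (e w)
    have := norm_nonneg (e w - 1)
    rcases h1 w hw with h | h <;> nlinarith
  by_contra hcon
  push Not at hcon
  nlinarith [norm_nonneg (e x), norm_nonneg (e x - 1)]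

theorem Subalgebra.exists_apply_eq_zero_one {A : Subalgebra ℂ C(X, ℂ)} (hA : A.SeparatesPoints)
    {p q : X} (hpq : p ≠ q) : ∃ f ∈ A, f p = 0 ∧ f q = 1 := by
  obtain ⟨_, ⟨f, hf, rfl⟩, hne⟩ := hA hpq
  refine ⟨(f q - f p)⁻¹ • (f - f p • (1 : C(X, ℂ))),
    A.smul_mem (A.sub_mem hf (A.smul_mem A.one_mem _)) _, by simp, ?_⟩
  have : f q - f p ≠ 0 := sub_ne_zero.2 (Ne.symm hne)
  simp [this]

variable [CompactSpace X]

/-- A minimal closed boundary. -/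
theorem exists_boundary_peaksEverywhere (A : Subalgebra ℂ C(X, ℂ)) {F : Set X} (hF : IsClosed F) :
    ∃ Y ⊆ F, IsClosed Y ∧ IsBoundaryFor A F Y ∧ PeaksEverywhere A Y := by
  obtain ⟨Y, hYF, hY⟩ := zorn_superset_nonempty
    {Y : Set X | Y ⊆ F ∧ IsClosed Y ∧ IsBoundaryFor A F Y} (fun c hc hchain hne => by
      refine ⟨⋂₀ c, ⟨?_, isClosed_sInter fun s hs => (hc hs).2.1, ?_⟩,
        fun s hs => sInter_subset_of_mem hs⟩
      · obtain ⟨s, hs⟩ := hne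
        exact (sInter_subset_of_mem hs).trans (hc hs).1
      · intro f hf x hx
        have : Nonempty c := hne.to_subtype
        have hcl : ∀ s : c, IsClosed ((s : Set X) ∩ {y | ‖f x‖ ≤ ‖f y‖}) := fun s =>
          (hc s.2).2.1.inter (isClosed_le continuous_const f.continuous.norm)
        obtain ⟨y, hy⟩ := IsCompact.nonempty_iInter_of_directed_nonempty_isCompact_isClosed
          (fun s : c => (s : Set X) ∩ {y | ‖f x‖ ≤ ‖f y‖})
          (by
            intro s t
            rcases hchain.total s.2 t.2 with h | h
            · exact ⟨s, subset_rfl, inter_subset_inter_left _ h⟩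
            · exact ⟨t, inter_subset_inter_left _ h, subset_rfl⟩)
          (fun s => by
            obtain ⟨y, hy, hxy⟩ := (hc s.2).2.2 f hf x hx
            exact ⟨y, hy, hxy⟩)
          (fun s => (hcl s).isCompact) hcl
        rw [mem_iInter] at hy
        exact ⟨y, fun s hs => (hy ⟨s, hs⟩).1, (hy (Classical.arbitrary c)).2⟩)
    F ⟨subset_rfl, hF, fun f _ x hx => ⟨x, hx, le_rfl⟩⟩
  obtain ⟨⟨_, hYc, hYb⟩, hmin⟩ := hY
  refine ⟨Y, hYF, hYc, hYb, fun U hU hUY => ?_⟩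
  by_contra hcon
  push Not at hcon
  -- If nothing peaks in `U`, deleting `U` leaves a smaller closed boundary.
  have hsub : Y ⊆ Y \ U := hmin ⟨sdiff_subset.trans hYF, hYc.sdiff hU, fun f hf x hx => by
    obtain ⟨y, hy, hxy⟩ := hYb f hf x hx
    by_cases hyU : y ∈ U
    · obtain ⟨q, hq, hle⟩ := hcon f hf y ⟨hyU, hy⟩
      exact ⟨q, hq, hxy.trans hle⟩
    · exact ⟨y, ⟨hy, hyU⟩, hxy⟩⟩ sdiff_subset
  obtain ⟨p, hpU, hpY⟩ := hUY
  exact (hsub hpY).2 hpU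

/-- A compact space has the CSWP if on each closed set with at least two points, on which a
separating algebra peaks everywhere, this algebra has a gap function. -/
theorem hasCSWP_of_gapFunction
    (h : ∀ (A : Subalgebra ℂ C(X, ℂ)) (Y : Set X), A.SeparatesPoints → IsClosed Y →
      Y.Nontrivial → PeaksEverywhere A Y → HasGapFunction A Y) : HasCSWP X := by
  intro A hA
  by_contra hdense
  obtain ⟨f, d, hd, hfd⟩ : ∃ f : C(X, ℂ), ∃ d > 0, ∀ g ∈ A, d ≤ ‖f - g‖ := by
    simp only [Dense, not_forall, Metric.mem_closure_iff] at hdense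
    obtain ⟨f, d, hd, hg⟩ := hdense
    push Not at hg
    exact ⟨f, d, hd, fun g hgA => by simpa [dist_eq_norm] using hg g hgA⟩
  -- On a minimal closed set where `f` keeps distance `d` from `A`, every proper closed subset
  -- admits an approximation strictly better than `d`.
  obtain ⟨F, -, hF⟩ := zorn_superset_nonempty
    {F : Set X | IsClosed F ∧ ∀ g ∈ A, ∃ x ∈ F, d ≤ ‖f x - g x‖} (fun c hc hchain hne => by
      refine ⟨⋂₀ c, ⟨isClosed_sInter fun s hs => (hc hs).1, ?_⟩,
        fun s hs => sInter_subset_of_mem hs⟩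
      intro g hg
      have : Nonempty c := hne.to_subtype
      have hcl : ∀ s : c, IsClosed ((s : Set X) ∩ {y | d ≤ ‖f y - g y‖}) := fun s =>
        (hc s.2).1.inter (isClosed_le continuous_const (f - g).continuous.norm)
      obtain ⟨y, hy⟩ := IsCompact.nonempty_iInter_of_directed_nonempty_isCompact_isClosed
        (fun s : c => (s : Set X) ∩ {y | d ≤ ‖f y - g y‖})
        (by
          intro s t
          rcases hchain.total s.2 t.2 with h | h
          · exact ⟨s, subset_rfl, inter_subset_inter_left _ h⟩
          · exact ⟨t, inter_subset_inter_left _ h, subset_rfl⟩)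
        (fun s => by
          obtain ⟨y, hy, hxy⟩ := (hc s.2).2 g hg
          exact ⟨y, hy, hxy⟩)
        (fun s => (hcl s).isCompact) hcl
      rw [mem_iInter] at hy
      exact ⟨y, fun s hs => (hy ⟨s, hs⟩).1, (hy (Classical.arbitrary c)).2⟩)
    univ ⟨isClosed_univ, fun g hg => by
      by_contra hcon
      push Not at hcon
      exact absurd (hfd g hg) (not_le.2 ((ContinuousMap.norm_lt_iff _ hd).2
        fun x => by simpa using hcon x))⟩
  obtain ⟨⟨hFc, hFd⟩, hmin⟩ := hF
  have hproper : ∀ F' ⊆ F, IsClosed F' → (∃ x ∈ F, x ∉ F') →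
      ∃ g ∈ A, ∀ x ∈ F', ‖f x - g x‖ < d := by
    intro F' hF' hcl ⟨x, hx, hx'⟩
    by_contra hcon
    push Not at hcon
    exact hx' (hmin ⟨hcl, hcon⟩ hF' hx)
  have hFnt : F.Nontrivial := by
    by_contra hs
    rw [not_nontrivial_iff] at hs
    obtain ⟨x, hx, -⟩ := hFd 0 A.zero_mem
    obtain ⟨y, hy, hyd⟩ := hFd (f x • 1) (A.smul_mem A.one_mem _)
    rw [hs hy hx] at hyd
    simp at hyd
    linarith
  -- A gap function splits `F` into two proper closed pieces. The good approximations `g0`, `g1` on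
  -- them are glued as `g0 + e * (g1 - g0)`, with `e` a high iterate of the gap function, and beat
  -- `d` on all of `F`.
  suffices hgap : HasGapFunction A F by
    obtain ⟨e0, he0, hval0, ⟨y, hyF, hy0⟩, ⟨z, hzF, hz0⟩⟩ := hgap
    have hgap : HasGapFunction A F := ⟨e0, he0, hval0, ⟨y, hyF, hy0⟩, ⟨z, hzF, hz0⟩⟩
    have habs : ∀ w : ℂ, ‖w‖ ≤ 1 / 4 → ‖w - 1‖ ≤ 1 / 4 → False := by
      intro w h1 h2
      have h3 := norm_sub_le w (w - 1)
      simp only [sub_sub_cancel, norm_one] at h3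
      linarith
    obtain ⟨g0, hg0, hf0⟩ := hproper (F ∩ {x | ‖e0 x‖ ≤ 1 / 4}) inter_subset_left
      (hFc.inter (isClosed_le e0.continuous.norm continuous_const))
      ⟨z, hzF, fun hz => habs _ hz.2 hz0⟩
    obtain ⟨g1, hg1, hf1⟩ := hproper (F ∩ {x | ‖e0 x - 1‖ ≤ 1 / 4}) inter_subset_left
      (hFc.inter (isClosed_le (e0 - 1).continuous.norm continuous_const))
      ⟨y, hyF, fun hz => habs _ hy0 hz.2⟩
    have hunif : ∀ (g : C(X, ℂ)) (K : Set X), IsClosed K → (∀ x ∈ K, ‖f x - g x‖ < d) →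
        ∃ η > 0, ∀ x ∈ K, ‖f x - g x‖ ≤ d - η := by
      intro g K hK hlt
      rcases K.eq_empty_or_nonempty with rfl | hne
      · exact ⟨1, one_pos, by simp⟩
      · obtain ⟨x, hx, hmax⟩ := hK.isCompact.exists_isMaxOn hne (f - g).continuous.norm.continuousOn
        refine ⟨d - ‖f x - g x‖, sub_pos.2 (hlt x hx), fun y hy => ?_⟩
        simpa using hmax hy
    obtain ⟨η0, hη0, hb0⟩ := hunif g0 _ (hFc.inter (isClosed_le e0.continuous.norm continuous_const)) hf0
    obtain ⟨η1, hη1, hb1⟩ := hunif g1 _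
      (hFc.inter (isClosed_le (e0 - 1).continuous.norm continuous_const)) hf1
    obtain ⟨n, hn⟩ := exists_pow_lt_of_lt_one
      (show 0 < min η0 η1 / (‖g0 - g1‖ + 1) by positivity) (by norm_num : (7 / 8 : ℝ) < 1)
    obtain ⟨e, he, hex⟩ := exists_iterate_smoothStep_mem he0 n
    obtain ⟨x, hxF, hx⟩ := hFd (g0 + e * (g1 - g0))
      (A.add_mem hg0 (A.mul_mem he (A.sub_mem hg1 hg0)))
    have hgx : ‖g1 x - g0 x‖ ≤ ‖g0 - g1‖ := by
      rw [norm_sub_rev]; exact (g0 - g1).norm_coe_le_norm x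
    have hsmall : (7 / 8 : ℝ) ^ n * ‖g1 x - g0 x‖ < min η0 η1 := by
      rw [lt_div_iff₀ (by positivity)] at hn
      refine lt_of_le_of_lt ?_ hn
      gcongr
      linarith
    simp only [ContinuousMap.add_apply, ContinuousMap.mul_apply, ContinuousMap.sub_apply] at hx
    rcases hval0 x hxF with h0 | h1
    · have a1 := hb0 x ⟨hxF, h0⟩
      have a2 : ‖e x * (g1 x - g0 x)‖ ≤ (7 / 8 : ℝ) ^ n * ‖g1 x - g0 x‖ := by
        rw [norm_mul, hex]
        gcongr
        exact norm_iterate_smoothStep_le h0 n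
      have a3 : ‖f x - (g0 x + e x * (g1 x - g0 x))‖ ≤ ‖f x - g0 x‖ + ‖e x * (g1 x - g0 x)‖ := by
        rw [← sub_sub]; exact norm_sub_le _ _
      linarith [min_le_left η0 η1]
    · have a1 := hb1 x ⟨hxF, h1⟩
      have a2 : ‖(e x - 1) * (g1 x - g0 x)‖ ≤ (7 / 8 : ℝ) ^ n * ‖g1 x - g0 x‖ := by
        rw [norm_mul, hex]
        gcongr
        exact norm_iterate_smoothStep_sub_one_le h1 n
      have a3 : ‖f x - (g0 x + e x * (g1 x - g0 x))‖ ≤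
          ‖f x - g1 x‖ + ‖(e x - 1) * (g1 x - g0 x)‖ := by
        rw [show f x - (g0 x + e x * (g1 x - g0 x)) =
          (f x - g1 x) - (e x - 1) * (g1 x - g0 x) by ring]
        exact norm_sub_le _ _
      linarith [min_le_right η0 η1]
  obtain ⟨Y, hYF, hYc, hYb, hpeak⟩ := exists_boundary_peaksEverywhere A hFc
  refine (h A Y hA hYc ?_ hpeak).of_boundary hYF hYb
  -- Were `Y` a single point `y`, each `g - g y` would vanish on the boundary and hence on `F`, so
  -- `A` could not separate `p` from `q`.
  obtain ⟨p, hp, q, hq, hpq⟩ := hFnt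
  by_contra hs
  rw [not_nontrivial_iff] at hs
  obtain ⟨g, hg, hgp, hgq⟩ := Subalgebra.exists_apply_eq_zero_one hA hpq
  obtain ⟨y, hy, -⟩ := hYb g hg p hp
  obtain ⟨w, hw, hle⟩ := hYb (g - g y • 1) (A.sub_mem hg (A.smul_mem A.one_mem _)) p hp
  obtain ⟨w', hw', hle'⟩ := hYb (g - g y • 1) (A.sub_mem hg (A.smul_mem A.one_mem _)) q hq
  rw [hs hw hy] at hle
  rw [hs hw' hy] at hle'
  simp [hgp, hgq] at hle hle'
  rw [hle] at hle'
  simp at hle'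

end Algebra

/-! ### The three sides of a point of the Cantor set. -/

section Side

open PiNat

/-- The position of `y` relative to `x`: it is `0` if `y` precedes `x` lexicographically, and
otherwise `1` or `2` according to the parity of the first index at which `x` and `y` differ. -/
noncomputable def side (x y : ℕ → Bool) : Fin 3 :=
  if x (firstDiff x y) then 0 else if Even (firstDiff x y) then 1 else 2

theorem firstDiff_eq_of {x y : ℕ → Bool} {n : ℕ} (h : ∀ k < n, x k = y k) (hn : x n ≠ y n) :
    firstDiff x y = n := by
  have hne : x ≠ y := fun e => hn (congrFun e n)
  refine le_antisymm ?_ ?_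
  · by_contra hlt
    exact hn (apply_eq_of_lt_firstDiff (not_le.1 hlt))
  · by_contra hlt
    exact apply_firstDiff_ne hne (h _ (not_le.1 hlt))

theorem side_eq {x y : ℕ → Bool} {n : ℕ} (h : ∀ k < n, x k = y k) (hn : x n ≠ y n) :
    side x y = if x n then 0 else if Even n then 1 else 2 := by
  rw [side, firstDiff_eq_of h hn]

theorem side_eq_zero_iff {x y : ℕ → Bool} :
    side x y = 0 ↔ x (firstDiff x y) = true := by
  unfold side
  split_ifs <;> simp_all

theorem side_eq_zero_of {x y : ℕ → Bool} {n : ℕ} (h : ∀ k < n, x k = y k) (hx : x n = true)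
    (hy : y n = false) : side x y = 0 := by
  rw [side_eq h (by simp [hx, hy]), if_pos hx]

/-- For distinct points, `side x y = 0` is the strict lexicographic order y < x. On the diagonal
`firstDiff x x = 0` by default and `side` is meaningless, whence the inequality hypotheses. -/
theorem side_comm_eq_zero_iff {x y : ℕ → Bool} (h : x ≠ y) : side x y = 0 ↔ side y x ≠ 0 := by
  rw [ne_eq, side_eq_zero_iff, side_eq_zero_iff, firstDiff_comm y x]
  have := apply_firstDiff_ne h
  revert this
  cases x (firstDiff x y) <;> cases y (firstDiff x y) <;> simp

theorem side_trans {x y z : ℕ → Bool} (hxy : x ≠ y) (hyz : y ≠ z) (h1 : side x y = 0)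
    (h2 : side y z = 0) : x ≠ z ∧ side x z = 0 := by
  rw [side_eq_zero_iff] at h1 h2
  have e1 := apply_firstDiff_ne hxy
  have e2 := apply_firstDiff_ne hyz
  have l1 := fun k => apply_eq_of_lt_firstDiff (x := x) (y := y) (n := k)
  have l2 := fun k => apply_eq_of_lt_firstDiff (x := y) (y := z) (n := k)
  generalize firstDiff x y = m at *
  generalize firstDiff y z = n at *
  have key : ∃ k, (∀ i < k, x i = z i) ∧ x k = true ∧ z k = false := by
    rcases lt_trichotomy m n with h | h | h
    · exact ⟨m, fun i hi => (l1 i hi).trans (l2 i (hi.trans h)), h1, by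
        rw [← l2 m h]; simpa [h1] using e1⟩
    · subst h
      simp_all
    · exact ⟨n, fun i hi => (l1 i (hi.trans h)).trans (l2 i hi), by rw [l1 n h, h2], by
        simpa [h2] using e2⟩
  obtain ⟨k, hk, hx, hz⟩ := key
  exact ⟨fun e => by simp [e, hz] at hx, side_eq_zero_of hk hx hz⟩

/-- Points agreeing up to `n` see every point outside their cylinder on the same side. -/
theorem side_congr {x x' y : ℕ → Bool} {n : ℕ} (h : x' ∈ cylinder x n) (hy : y ∉ cylinder x n) :
    side x y = side x' y := by
  have hne : x ≠ y := fun e => hy (e ▸ self_mem_cylinder x n)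
  have hlt : firstDiff x y < n := by
    by_contra hle
    exact hy ((mem_cylinder_iff_le_firstDiff hne.symm n).2
      (by rw [firstDiff_comm]; exact not_lt.1 hle))
  have hagree : ∀ k < n, x' k = x k := h
  rw [side_eq (n := firstDiff x y) (x := x')
    (fun k hk => (hagree k (hk.trans hlt)).trans (apply_eq_of_lt_firstDiff hk))
    (by rw [hagree _ hlt]; exact apply_firstDiff_ne hne), hagree _ hlt]
  rfl

theorem side_congr_right {x y y' : ℕ → Bool} (hne : x ≠ y)
    (h : y' ∈ cylinder y (firstDiff x y + 1)) : x ≠ y' ∧ side x y' = side x y := by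
  have hagree : ∀ k < firstDiff x y + 1, y' k = y k := h
  have h2 : x (firstDiff x y) ≠ y' (firstDiff x y) := by
    rw [hagree _ (Nat.lt_succ_self _)]; exact apply_firstDiff_ne hne
  refine ⟨fun e => h2 (by rw [← e]), ?_⟩
  rw [side_eq (fun k hk => (apply_eq_of_lt_firstDiff hk).trans
    (hagree k (hk.trans (Nat.lt_succ_self _))).symm) h2]
  rfl

theorem isClopen_cylinder (x : ℕ → Bool) (n : ℕ) : IsClopen (cylinder x n) := by
  rw [cylinder_eq_pi]
  exact ⟨isClosed_set_pi fun _ _ => isClosed_discrete _,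
    isOpen_set_pi (Finset.finite_toSet _) fun _ _ => isOpen_discrete _⟩

end Side

/-! ### Spaces with a splitting: neighbourhoods and two-sided points. -/

/-- A splitting of the points of (a subset of) the Cantor set into at most three points each,
which are told apart by the sides from which they are approached. -/
structure SplitMap (X : Type u) [TopologicalSpace X] where
  /-- The projection to the Cantor set. -/
  proj : X → ℕ → Bool
  /-- The position of a point of `X` relative to a point of the Cantor set. -/
  label : (ℕ → Bool) → X → Fin 3
  continuous_proj : Continuous proj
  continuous_label : ∀ x, Continuous (label x)
  label_eq : ∀ x z, x ≠ proj z → label x z = side x (proj z)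
  ext : ∀ z w, proj z = proj w → label (proj z) z = label (proj z) w → z = w

namespace SplitMap

open PiNat

variable {X : Type u} [TopologicalSpace X] (σ : SplitMap X)

/-- The restriction of a splitting to a subspace. -/
def restrict (S : Set X) : SplitMap S where
  proj z := σ.proj z
  label x z := σ.label x z
  continuous_proj := σ.continuous_proj.comp continuous_subtype_val
  continuous_label x := (σ.continuous_label x).comp continuous_subtype_val
  label_eq x z h := σ.label_eq x z h
  ext z w h h' := Subtype.ext (σ.ext z w h h')

theorem finite_fibre (x : ℕ → Bool) : {z | σ.proj z = x}.Finite := by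
  refine Set.Finite.of_finite_image (f := σ.label x) (Set.toFinite _) fun z hz w hw h => ?_
  obtain rfl : σ.proj z = x := hz
  exact σ.ext z w (Eq.symm hw) h

theorem isClopen_label (x : ℕ → Bool) (s : Set (Fin 3)) : IsClopen (σ.label x ⁻¹' s) :=
  (isClopen_discrete s).preimage (σ.continuous_label x)

theorem isClopen_cylinder (x : ℕ → Bool) (n : ℕ) : IsClopen (σ.proj ⁻¹' cylinder x n) :=
  (_root_.isClopen_cylinder x n).preimage σ.continuous_proj

theorem countable_of_proj {C : Set X} (h : (σ.proj '' C).Countable) : C.Countable := by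
  have : C ⊆ ⋃ x ∈ σ.proj '' C, {z | σ.proj z = x} := fun z hz => by
    simp only [mem_iUnion]
    exact ⟨σ.proj z, mem_image_of_mem _ hz, rfl⟩
  exact (h.biUnion fun x _ => (σ.finite_fibre x).countable).mono this

/-- Initial segments are increasing. -/
theorem label_eq_zero_mono {x x' : ℕ → Bool} (hne : x ≠ x') (h : side x x' = 0) {z : X}
    (hz : σ.label x' z = 0) : σ.label x z = 0 := by
  by_cases hx' : x' = σ.proj z
  · rw [σ.label_eq x z (hx' ▸ hne), ← hx', h]
  · rw [σ.label_eq x' z hx'] at hz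
    obtain ⟨h1, h2⟩ := side_trans hne hx' h hz
    rw [σ.label_eq x z h1, h2]

theorem proj_mem_cylinder_of_label_ne {x x' : ℕ → Bool} {n : ℕ} (h : x' ∈ cylinder x n) {z : X}
    (hz : σ.label x z ≠ σ.label x' z) : σ.proj z ∈ cylinder x n := by
  by_contra hcon
  have h1 : x ≠ σ.proj z := fun e => hcon (e ▸ self_mem_cylinder x n)
  have h2 : x' ≠ σ.proj z := fun e => hcon (e ▸ h)
  rw [σ.label_eq x z h1, σ.label_eq x' z h2] at hz
  exact hz (side_congr h hcon)

variable [CompactSpace X]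

/-- A tube lemma: the preimages of the cylinders are compact and shrink to the fibre. -/
theorem exists_cylinder_subset {x : ℕ → Bool} {O : Set X} (hO : IsOpen O)
    (h : ∀ z, σ.proj z = x → z ∈ O) : ∃ n, ∀ z, σ.proj z ∈ cylinder x n → z ∈ O := by
  by_contra hcon
  push Not at hcon
  have hcl : ∀ n, IsClosed (σ.proj ⁻¹' cylinder x n \ O) := fun n =>
    (σ.isClopen_cylinder x n).isClosed.sdiff hO
  obtain ⟨z, hz⟩ := IsCompact.nonempty_iInter_of_sequence_nonempty_isCompact_isClosed
    (fun n => σ.proj ⁻¹' cylinder x n \ O)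
    (fun n => sdiff_subset_sdiff_left (preimage_mono (cylinder_anti x n.le_succ)))
    (fun n => by
      obtain ⟨z, h1, h2⟩ := hcon n
      exact ⟨z, h1, h2⟩)
    (hcl 0).isCompact hcl
  rw [mem_iInter] at hz
  refine (hz 0).2 (h z (funext fun k => ?_))
  exact (hz (k + 1)).1 k (Nat.lt_succ_self k)

/-- Within its fibre a point is determined by its label, so the other fibre points can be absorbed
by a clopen set of different labels. -/
theorem exists_cylinder_label_subset {z : X} {O : Set X} (hO : IsOpen O) (hz : z ∈ O) :
    ∃ n, ∀ w, σ.proj w ∈ cylinder (σ.proj z) n →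
      σ.label (σ.proj z) w = σ.label (σ.proj z) z → w ∈ O := by
  obtain ⟨n, hn⟩ := σ.exists_cylinder_subset (x := σ.proj z)
    (hO.union (σ.isClopen_label (σ.proj z) {σ.label (σ.proj z) z}ᶜ).isOpen) (fun w hw => by
      by_cases h : σ.label (σ.proj z) w = σ.label (σ.proj z) z
      · left
        rwa [← σ.ext z w hw.symm h.symm]
      · exact Or.inr h)
  exact ⟨n, fun w hw h => (hn w hw).resolve_right fun h' => h' h⟩

/-- By compactness an exceptional x has a cylinder over which `Y` has no label in `P` relative to x.
Two exceptional points with the same such prefix would contradict `hP`, so the prefix determines x.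
-/
theorem countable_not_approached {Y : Set X} (hY : IsClosed Y) (P : Set (Fin 3))
    (hP : ∀ x y : ℕ → Bool, x ≠ y → side x y ∈ P ∨ side y x ∈ P) :
    {x ∈ σ.proj '' Y | ¬ ∃ z ∈ Y, σ.proj z = x ∧ σ.label x z ∈ P}.Countable := by
  have hn : ∀ x ∈ {x ∈ σ.proj '' Y | ¬ ∃ z ∈ Y, σ.proj z = x ∧ σ.label x z ∈ P}, ∃ n, ∀ z ∈ Y,
      σ.proj z ∈ cylinder x n → σ.label x z ∉ P := by
    rintro x ⟨-, hx⟩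
    obtain ⟨n, hn⟩ := σ.exists_cylinder_subset (x := x)
      (hY.isOpen_compl.union (σ.isClopen_label x Pᶜ).isOpen) (fun z hz => by
        by_contra hcon
        simp only [mem_union, mem_compl_iff, mem_preimage, not_or, not_not] at hcon
        exact hx ⟨z, hcon.1, hz, hcon.2⟩)
    exact ⟨n, fun z hzY hz => (hn z hz).resolve_left fun h => h hzY⟩
  choose! n hn using hn
  have hinj : InjOn (fun x => (⟨n x, fun i => x i⟩ : Σ n, Fin n → Bool))
      {x ∈ σ.proj '' Y | ¬ ∃ z ∈ Y, σ.proj z = x ∧ σ.label x z ∈ P} := by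
    intro x hx y hy hxy
    by_contra hne
    have hnn : n x = n y := congrArg Sigma.fst hxy
    have hag : ∀ k < n x, x k = y k := by
      intro k hk
      simp only [Sigma.mk.injEq] at hxy
      have := hxy.2
      generalize n y = m at *
      subst hnn
      exact congrFun (eq_of_heq this) ⟨k, hk⟩
    obtain ⟨⟨z, hzY, hz⟩, -⟩ := id hx
    obtain ⟨⟨w, hwY, hw⟩, -⟩ := id hy
    rcases hP x y hne with h | h
    · refine hn x hx w hwY (by rw [hw]; exact fun k hk => (hag k hk).symm) ?_
      rwa [σ.label_eq x w (by rwa [hw]), hw]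
    · refine hn y hy z hzY (by rw [hz]; exact fun k hk => hag k (hnn ▸ hk)) ?_
      rwa [σ.label_eq y z (by rw [hz]; exact Ne.symm hne), hz]
  exact Set.MapsTo.countable_of_injOn (mapsTo_univ _ _) hinj countable_univ

/-- The points whose fibre in `Y` contains points approached from the left and from the right. -/
def twoSided (Y : Set X) : Set (ℕ → Bool) :=
  {x | (∃ z ∈ Y, σ.proj z = x ∧ σ.label x z = 0) ∧ ∃ z ∈ Y, σ.proj z = x ∧ σ.label x z ≠ 0}

theorem countable_diff_twoSided {Y : Set X} (hY : IsClosed Y) :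
    (σ.proj '' Y \ σ.twoSided Y).Countable := by
  refine ((σ.countable_not_approached hY {0} fun x y h => ?_).union
    (σ.countable_not_approached hY {0}ᶜ fun x y h => ?_)).mono ?_
  · simp only [mem_singleton_iff]
    by_cases h' : side y x = 0
    · exact Or.inr h'
    · exact Or.inl ((side_comm_eq_zero_iff h).2 h')
  · simp only [mem_compl_iff, mem_singleton_iff]
    by_cases h' : side x y = 0
    · exact Or.inr ((side_comm_eq_zero_iff h).1 h')
    · exact Or.inl h'
  · rintro x ⟨hx, hx'⟩
    by_contra hcon
    simp only [mem_union, not_or] at hcon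
    exact hx' ⟨by_contra fun h => hcon.1 ⟨hx, h⟩, by_contra fun h => hcon.2 ⟨hx, h⟩⟩

end SplitMap

/-! ### Peak functions and the Baire theorem. -/

section Peaks

variable {X : Type u} [TopologicalSpace X]

theorem exists_isolated_of_finite [T1Space X] {Y U : Set X} (hU : IsOpen U)
    (hne : (U ∩ Y).Nonempty) (hfin : (U ∩ Y).Finite) :
    ∃ p, ∃ V : Set X, IsOpen V ∧ V ∩ Y = {p} := by
  obtain ⟨p, hp⟩ := hne
  refine ⟨p, U \ ((U ∩ Y) \ {p}), hU.sdiff (hfin.subset sdiff_subset).isClosed, ?_⟩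
  ext y
  constructor
  · rintro ⟨⟨hyU, hy⟩, hyY⟩
    by_contra hne
    exact hy ⟨⟨hyU, hyY⟩, hne⟩
  · rintro rfl
    exact ⟨⟨hp.1, fun h => h.2 rfl⟩, hp.2⟩

theorem Subalgebra.exists_apply_eq_zero_and_one {A : Subalgebra ℂ C(X, ℂ)}
    (hA : A.SeparatesPoints) {S : Set X} (hS : S.Finite) {p : X} (hp : p ∉ S) :
    ∃ f ∈ A, f p = 0 ∧ ∀ q ∈ S, f q = 1 := by
  induction S, hS using Set.Finite.induction_on with
  | empty => exact ⟨0, A.zero_mem, rfl, by simp⟩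
  | @insert a S _ _ ih =>
    obtain ⟨f, hf, hfp, hfS⟩ := ih fun h => hp (mem_insert_of_mem _ h)
    obtain ⟨g, hg, hgp, hga⟩ := Subalgebra.exists_apply_eq_zero_one hA
      (fun h : p = a => hp (h ▸ mem_insert a S))
    refine ⟨1 - (1 - f) * (1 - g), A.sub_mem A.one_mem (A.mul_mem (A.sub_mem A.one_mem hf)
      (A.sub_mem A.one_mem hg)), by simp [hfp, hgp], ?_⟩
    rintro q (rfl | hq)
    · simp [hga]
    · simp [hfS q hq]

variable [CompactSpace X]

/-- A maximum point `m` of |f| on `Y` must lie in `U`; high powers of f / f(m) are small off `U`. -/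
theorem PeaksEverywhere.exists_peak {A : Subalgebra ℂ C(X, ℂ)} {Y U : Set X}
    (h : PeaksEverywhere A Y) (hY : IsClosed Y) (hU : IsOpen U) (hUY : (U ∩ Y).Nonempty)
    {ε : ℝ} (hε : 0 < ε) :
    ∃ f ∈ A, (∃ p ∈ U ∩ Y, f p = 1) ∧ (∀ y ∈ Y, ‖f y‖ ≤ 1) ∧ ∀ y ∈ Y \ U, ‖f y‖ ≤ ε := by
  obtain ⟨f, hf, p, ⟨hpU, hpY⟩, hp⟩ := h U hU hUY
  rcases (Y \ U).eq_empty_or_nonempty with he | hne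
  · exact ⟨1, A.one_mem, ⟨p, ⟨hpU, hpY⟩, rfl⟩, by simp, by simp [he]⟩
  obtain ⟨m, hmY, hmax⟩ := hY.isCompact.exists_isMaxOn ⟨p, hpY⟩ f.continuous.norm.continuousOn
  obtain ⟨r, hr, hrmax⟩ := (hY.sdiff hU).isCompact.exists_isMaxOn hne f.continuous.norm.continuousOn
  have hpm : ‖f p‖ ≤ ‖f m‖ := hmax hpY
  have hrm : ‖f r‖ < ‖f m‖ := (hp r hr).trans_le hpm
  have hm0 : 0 < ‖f m‖ := (norm_nonneg _).trans_lt hrm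
  have hmU : m ∈ U := by
    by_contra hm
    exact absurd (hp m ⟨hmY, hm⟩) (not_lt.2 hpm)
  obtain ⟨n, hn⟩ := exists_pow_lt_of_lt_one hε ((div_lt_one hm0).2 hrm)
  refine ⟨((f m)⁻¹ • f) ^ n, A.pow_mem (A.smul_mem hf _) n, ⟨m, ⟨hmU, hmY⟩, ?_⟩, ?_, ?_⟩
  · simp [norm_pos_iff.1 hm0]
  · intro y hy
    have : ‖f y‖ ≤ ‖f m‖ := hmax hy
    simp only [ContinuousMap.pow_apply, ContinuousMap.smul_apply, smul_eq_mul, norm_pow, norm_mul,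
      norm_inv]
    refine pow_le_one₀ (by positivity) ?_
    rwa [inv_mul_le_iff₀ hm0, mul_one]
  · intro y hy
    have : ‖f y‖ ≤ ‖f r‖ := hrmax hy
    simp only [ContinuousMap.pow_apply, ContinuousMap.smul_apply, smul_eq_mul, norm_pow, norm_mul,
      norm_inv]
    refine le_trans ?_ hn.le
    rw [div_eq_inv_mul]
    gcongr

theorem PeaksEverywhere.hasGapFunction_of_isolated {A : Subalgebra ℂ C(X, ℂ)} {Y U : Set X}
    (h : PeaksEverywhere A Y) (hY : IsClosed Y) (hnt : Y.Nontrivial) (hU : IsOpen U) {p : X}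
    (hUY : U ∩ Y = {p}) : HasGapFunction A Y := by
  obtain ⟨f, hf, ⟨q, hq, hq1⟩, -, hsmall⟩ :=
    h.exists_peak hY hU (hUY ▸ singleton_nonempty p) (show (0 : ℝ) < 1 / 4 by norm_num)
  obtain rfl : q = p := hUY.le hq
  have hoff : ∀ y ∈ Y, y ≠ q → ‖f y‖ ≤ 1 / 4 := fun y hy hne =>
    hsmall y ⟨hy, fun hyU => hne (hUY.le ⟨hyU, hy⟩)⟩
  obtain ⟨y, hy, hyq⟩ := hnt.exists_ne q
  refine ⟨f, hf, fun y hy => ?_, ⟨y, hy, hoff y hy hyq⟩, ⟨q, hq.2, by simp [hq1]⟩⟩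
  by_cases hyq : y = q
  · right; simp [hyq, hq1]
  · exact Or.inl (hoff y hy hyq)

/-- Baire category theorem for closed subsets of a compact Hausdorff space. -/
theorem IsClosed.exists_open_inter_subset_of_sUnion [T2Space X] {Y : Set X} (hY : IsClosed Y)
    (hne : Y.Nonempty) {c : Set (Set X)} (hc : c.Countable) (hcl : ∀ C ∈ c, IsClosed C)
    (hcov : Y ⊆ ⋃₀ c) : ∃ C ∈ c, ∃ U : Set X, IsOpen U ∧ (U ∩ Y).Nonempty ∧ U ∩ Y ⊆ C := by
  have : CompactSpace Y := isCompact_iff_compactSpace.1 hY.isCompact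
  have : Nonempty Y := hne.to_subtype
  have : Countable c := hc.to_subtype
  obtain ⟨C, y, hy⟩ := nonempty_interior_of_iUnion_of_closed
    (f := fun C : c => (Subtype.val : Y → X) ⁻¹' C)
    (fun C => (hcl C C.2).preimage continuous_subtype_val) (by
      rw [eq_univ_iff_forall]
      intro y
      obtain ⟨C, hC, hyC⟩ := hcov y.2
      exact mem_iUnion.2 ⟨⟨C, hC⟩, hyC⟩)
  obtain ⟨U, hU, hUi⟩ := isOpen_induced_iff.1 (isOpen_interior
    (s := (Subtype.val : Y → X) ⁻¹' C))
  refine ⟨C, C.2, U, hU, ⟨y, ?_, y.2⟩, ?_⟩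
  · exact hUi.ge hy
  · rintro x ⟨hxU, hxY⟩
    have : (⟨x, hxY⟩ : Y) ∈ interior ((Subtype.val : Y → X) ⁻¹' C) := hUi.le hxU
    exact show (⟨x, hxY⟩ : Y) ∈ (Subtype.val : Y → X) ⁻¹' C from interior_subset this

end Peaks

theorem not_countable_nat_bool : ¬ Countable (ℕ → Bool) := by
  intro h
  obtain ⟨f, hf⟩ := exists_surjective_nat (ℕ → Bool)
  obtain ⟨n, hn⟩ := hf fun k => !f k k
  simpa using congrFun hn n

/-! ### Gap functions, the CSWP, and absence of Cantor sets. -/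

namespace SplitMap

open PiNat

variable {X : Type u} [TopologicalSpace X] [CompactSpace X]

/-- Some function of a separating algebra jumps locally at a two-sided point. -/
theorem exists_local_jump (σ : SplitMap X) {A : Subalgebra ℂ C(X, ℂ)} (hA : A.SeparatesPoints) {Y : Set X}
    {x : ℕ → Bool} (hx : x ∈ σ.twoSided Y) {δ : ℝ} (hδ : 0 < δ) :
    ∃ (n m : ℕ), ∃ g ∈ A, (∀ z, ‖g z‖ ≤ m) ∧ ∀ z ∈ Y, σ.proj z ∈ cylinder x n →
      (σ.label x z = 0 → ‖g z‖ ≤ δ) ∧ (σ.label x z ≠ 0 → ‖g z - 1‖ ≤ δ) := by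
  obtain ⟨⟨p, hpY, hpx, hp0⟩, -⟩ := hx
  obtain ⟨g, hg, hgp, hgS⟩ := Subalgebra.exists_apply_eq_zero_and_one hA
    (S := {z | σ.proj z = x ∧ σ.label x z ≠ 0})
    ((σ.finite_fibre x).subset fun z hz => hz.1) (p := p) (fun h => h.2 hp0)
  obtain ⟨n, hn⟩ := σ.exists_cylinder_subset (x := x)
    (O := (σ.label x ⁻¹' {0} ∩ {z | ‖g z‖ < δ}) ∪ (σ.label x ⁻¹' {0}ᶜ ∩ {z | ‖g z - 1‖ < δ}))
    (((σ.isClopen_label x _).isOpen.inter (isOpen_lt g.continuous.norm continuous_const)).union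
      ((σ.isClopen_label x _).isOpen.inter
        (isOpen_lt (g - 1).continuous.norm continuous_const))) (by
      intro z hz
      by_cases h : σ.label x z = 0
      · left
        refine ⟨h, ?_⟩
        obtain rfl : z = p := σ.ext z p (hz.trans hpx.symm) (by rw [hz, h, hp0])
        simpa [hgp] using hδ
      · right
        refine ⟨h, ?_⟩
        simpa [hgS z ⟨hz, h⟩] using hδ)
  obtain ⟨m, hm⟩ := exists_nat_ge ‖g‖
  refine ⟨n, m, g, hg, fun z => (g.norm_coe_le_norm z).trans hm, fun z _ hz => ⟨fun h => ?_, fun h => ?_⟩⟩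
  · rcases hn z hz with h' | h'
    · exact le_of_lt h'.2
    · exact absurd h h'.1
  · rcases hn z hz with h' | h'
    · exact absurd h'.1 h
    · exact le_of_lt h'.2

/-- In a set without isolated points every neighbourhood contains a cylinder meeting the set. -/
theorem exists_cylinder_subset_of_infinite (σ : SplitMap X) {Y O : Set X}
    (hinf : ∀ U : Set X, IsOpen U → (U ∩ Y).Nonempty → (U ∩ Y).Infinite) (hO : IsOpen O)
    (hne : (O ∩ Y).Nonempty) :
    ∃ (a : ℕ → Bool) (k : ℕ), (σ.proj ⁻¹' cylinder a k ∩ Y).Nonempty ∧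
      σ.proj ⁻¹' cylinder a k ⊆ O := by
  obtain ⟨p, hpO, hpY⟩ := hne
  obtain ⟨n, hn⟩ := σ.exists_cylinder_label_subset hO hpO
  obtain ⟨q, ⟨⟨hq1, hq2⟩, hqY⟩, hqp⟩ := (hinf (σ.proj ⁻¹' cylinder (σ.proj p) n ∩
    σ.label (σ.proj p) ⁻¹' {σ.label (σ.proj p) p})
    ((σ.isClopen_cylinder _ n).isOpen.inter (σ.isClopen_label _ _).isOpen)
    ⟨p, ⟨self_mem_cylinder _ _, rfl⟩, hpY⟩).exists_notMem_finite (finite_singleton p)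
  -- A short cylinder around `proj q` lies on one side of `proj p`, the one recorded by the label of
  -- `p`; so no label condition is needed any more.
  have hne : σ.proj p ≠ σ.proj q := fun h => hqp (σ.ext p q h hq2.symm).symm
  refine ⟨σ.proj q, max n (firstDiff (σ.proj p) (σ.proj q) + 1),
    ⟨q, self_mem_cylinder _ _, hqY⟩, fun w hw => ?_⟩
  obtain ⟨h1, h2⟩ := side_congr_right hne (cylinder_anti _ (le_max_right n _) hw)
  refine hn w (fun k hk => ?_) ?_
  · rw [cylinder_anti _ (le_max_left n _) hw k hk, hq1 k hk]
  · rw [σ.label_eq _ w h1, h2, ← σ.label_eq _ q hne]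
    exact hq2

variable [T2Space X]

theorem hasGapFunction (σ : SplitMap X) {A : Subalgebra ℂ C(X, ℂ)} (hA : A.SeparatesPoints) {Y : Set X}
    (hY : IsClosed Y) (hnt : Y.Nontrivial) (hpeak : PeaksEverywhere A Y) :
    HasGapFunction A Y := by
  by_cases hiso : ∃ p, ∃ V : Set X, IsOpen V ∧ V ∩ Y = {p}
  · obtain ⟨p, V, hV, hVY⟩ := hiso
    exact hpeak.hasGapFunction_of_isolated hY hnt hV hVY
  have hinf : ∀ U : Set X, IsOpen U → (U ∩ Y).Nonempty → (U ∩ Y).Infinite := fun U hU hne hfin =>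
    hiso (exists_isolated_of_finite hU hne hfin)
  -- With jumps and peak accurate to 1/20, the errors below add up to less than 1/4.
  choose! n m g hgA hgm hg using fun x (hx : x ∈ σ.twoSided Y) =>
    σ.exists_local_jump hA hx (show (0 : ℝ) < 1 / 20 by norm_num)
  let S : ((Σ k, Fin k → Bool) × ℕ) → Set (ℕ → Bool) := fun j =>
    {x ∈ σ.twoSided Y | (⟨n x, fun i => x i⟩ : Σ k, Fin k → Bool) = j.1 ∧ m x = j.2}
  -- There are countably many pairs of prefix and norm bound, and countably many fibres over points
  -- that are not two-sided. Those fibres are finite, so none contains an open piece of `Y`; hence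
  -- one pair is dense in such a piece.
  obtain ⟨C, hC, U, hU, hUY, hUC⟩ := hY.exists_open_inter_subset_of_sUnion hnt.nonempty
    (c := range (fun j => closure (Y ∩ σ.proj ⁻¹' S j)) ∪
      (fun x => {z | σ.proj z = x}) '' (σ.proj '' Y \ σ.twoSided Y))
    ((countable_range _).union ((σ.countable_diff_twoSided hY).image _))
    (by
      rintro C (⟨j, rfl⟩ | ⟨x, -, rfl⟩)
      · exact isClosed_closure
      · exact (σ.finite_fibre x).isClosed)
    (by
      intro z hz
      by_cases h : σ.proj z ∈ σ.twoSided Y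
      · exact ⟨_, Or.inl ⟨(⟨n (σ.proj z), fun i => σ.proj z i⟩, m (σ.proj z)), rfl⟩,
          subset_closure ⟨hz, h, rfl, rfl⟩⟩
      · exact ⟨_, Or.inr ⟨σ.proj z, ⟨⟨z, hz, rfl⟩, h⟩, rfl⟩, rfl⟩)
  rcases hC with ⟨⟨⟨N, s⟩, M⟩, rfl⟩ | ⟨x, -, rfl⟩
  swap
  · exact absurd ((σ.finite_fibre x).subset hUC) (hinf U hU hUY)
  simp only at hUC
  have hS : ∀ x ∈ S ⟨⟨N, s⟩, M⟩, x ∈ σ.twoSided Y ∧ n x = N ∧ m x = M ∧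
      ∀ i : Fin N, x i = s i := by
    rintro x ⟨hx, hj, hm⟩
    simp only at hj hm
    refine ⟨hx, congrArg Sigma.fst hj, hm, ?_⟩
    have h1 : n x = N := congrArg Sigma.fst hj
    simp only [Sigma.mk.injEq] at hj
    have h2 := hj.2
    clear hj
    generalize n x = k at *
    subst h1
    exact congrFun (eq_of_heq h2)
  -- Off `U` the jump functions are bounded only by `M`; this smallness absorbs the factors |g x'| ≤
  -- M and |1 - g x| ≤ M + 1.
  obtain ⟨f, hf, ⟨p, hp, hfp⟩, hf1, hfε⟩ := hpeak.exists_peak hY hU hUY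
    (show (0 : ℝ) < 1 / (4 * (M + 1) ^ 2) by positivity)
  obtain ⟨a, k, hak, hakO⟩ := σ.exists_cylinder_subset_of_infinite hinf
    (hU.inter (isOpen_lt (f - 1).continuous.norm continuous_const))
    (O := U ∩ {z | ‖(f - 1) z‖ < 1 / 20}) ⟨p, ⟨hp.1, by simp [hfp]⟩, hp.2⟩
  have hcyl : ∀ V : Set X, IsOpen V → V ⊆ σ.proj ⁻¹' cylinder a k → (V ∩ Y).Nonempty →
      ∃ w ∈ V, σ.proj w ∈ S ⟨⟨N, s⟩, M⟩ := by
    rintro V hV hVa ⟨w, hwV, hwY⟩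
    obtain ⟨v, hvV, -, hv⟩ := mem_closure_iff.1 (hUC ⟨(hakO (hVa hwV)).1, hwY⟩) V hV hwV
    exact ⟨v, hvV, hv⟩
  have hpair : ∃ x ∈ S ⟨⟨N, s⟩, M⟩, ∃ x' ∈ S ⟨⟨N, s⟩, M⟩, x ∈ cylinder a k ∧ x' ∈ cylinder a k ∧
      x ≠ x' ∧ side x x' = 0 := by
    obtain ⟨w, hwa, hw⟩ := hcyl _ (σ.isClopen_cylinder a k).isOpen subset_rfl hak
    obtain ⟨v, hva, hv⟩ := hcyl (σ.proj ⁻¹' cylinder a k \ {z | σ.proj z = σ.proj w})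
      ((σ.isClopen_cylinder a k).isOpen.sdiff (σ.finite_fibre _).isClosed) sdiff_subset (by
        obtain ⟨v, hv, hv'⟩ := (hinf _ (σ.isClopen_cylinder a k).isOpen hak).exists_notMem_finite
          (σ.finite_fibre (σ.proj w))
        exact ⟨v, ⟨hv.1, hv'⟩, hv.2⟩)
    have hne : σ.proj v ≠ σ.proj w := hva.2
    by_cases h : side (σ.proj v) (σ.proj w) = 0
    · exact ⟨_, hv, _, hw, hva.1, hwa, hne, h⟩
    · exact ⟨_, hw, _, hv, hwa, hva.1, hne.symm, (side_comm_eq_zero_iff hne.symm).2 h⟩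
  obtain ⟨x, hxS, x', hxS', hxa, hxa', hne, hside⟩ := hpair
  obtain ⟨hxT, hnx, hmx, hxs⟩ := hS x hxS
  obtain ⟨hxT', hnx', hmx', hxs'⟩ := hS x' hxS'
  have gx := hg x hxT
  have gx' := hg x' hxT'
  have bx : ∀ z, ‖g x z‖ ≤ M := fun z => hmx ▸ hgm x hxT z
  have bx' : ∀ z, ‖g x' z‖ ≤ M := fun z => hmx' ▸ hgm x' hxT' z
  have hagree : x' ∈ cylinder x N := fun i hi => by rw [hxs ⟨i, hi⟩, hxs' ⟨i, hi⟩]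
  have hagree' : x ∈ cylinder x' N := fun i hi => (hagree i hi).symm
  have hUN : ∀ w ∈ U ∩ Y, σ.proj w ∈ cylinder x N := by
    intro w hw
    refine (σ.isClopen_cylinder x N).isClosed.closure_subset_iff.2 ?_ (hUC hw)
    rintro v ⟨-, hv⟩ i hi
    rw [hxs ⟨i, hi⟩, ← (hS _ hv).2.2.2 ⟨i, hi⟩]
  have hUN' : ∀ w ∈ U ∩ Y, σ.proj w ∈ cylinder x' N := fun w hw i hi => by
    rw [hUN w hw i hi, hagree i hi]
  -- The product imitates the indicator of the interval from `x'` to `x`, which lies over the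
  -- cylinder of `a`, where `f` is near 1. In the rest of `U` one jump factor is small; off `U`, `f`
  -- is.
  have key : ∀ w ∈ Y,
      (σ.label x' w ≠ 0 → σ.label x w = 0 → ‖(f * g x' * (1 - g x)) w - 1‖ ≤ 1 / 4) ∧
      (¬ (σ.label x' w ≠ 0 ∧ σ.label x w = 0) → ‖(f * g x' * (1 - g x)) w‖ ≤ 1 / 4) := by
    intro w hw
    simp only [ContinuousMap.mul_apply, ContinuousMap.sub_apply, ContinuousMap.one_apply]
    constructor
    · intro h' h
      have hwa : σ.proj w ∈ cylinder a k := by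
        have h1 := σ.proj_mem_cylinder_of_label_ne (x := x) (x' := x') (n := k)
          (fun i hi => by rw [hxa i hi, hxa' i hi]) (z := w) (by rw [h]; exact h'.symm)
        exact fun i hi => by rw [h1 i hi, hxa i hi]
      obtain ⟨hwU, hwf⟩ := hakO hwa
      have e1 : ‖f w - 1‖ ≤ 1 / 20 := le_of_lt hwf
      have e2 := (gx' w hw (hnx' ▸ hUN' w ⟨hwU, hw⟩)).2 h'
      have e3 := (gx w hw (hnx ▸ hUN w ⟨hwU, hw⟩)).1 h
      have hfw := hf1 w hw
      have e4 : ‖g x' w‖ ≤ 21 / 20 := by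
        have := norm_add_le (g x' w - 1) 1
        simp only [sub_add_cancel, norm_one] at this
        linarith
      have e5 : f w * g x' w * (1 - g x w) - 1 =
          (f w - 1) + (f w * (g x' w - 1) - f w * g x' w * g x w) := by ring
      have e6 : ‖f w * (g x' w - 1)‖ ≤ 1 * (1 / 20) := by
        rw [norm_mul]; gcongr
      have e7 : ‖f w * g x' w * g x w‖ ≤ 1 * (21 / 20) * (1 / 20) := by
        rw [norm_mul, norm_mul]; gcongr
      rw [e5]
      refine (norm_add_le _ _).trans ?_
      have := norm_sub_le (f w * (g x' w - 1)) (f w * g x' w * g x w)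
      linarith
    · intro hcase
      rw [norm_mul, norm_mul]
      have n1 : ‖1 - g x w‖ ≤ 1 + ‖g x w‖ := (norm_sub_le _ _).trans (by simp)
      by_cases hwU : w ∈ U
      · have hfw := hf1 w hw
        have j := gx w hw (hnx ▸ hUN w ⟨hwU, hw⟩)
        have j' := gx' w hw (hnx' ▸ hUN' w ⟨hwU, hw⟩)
        by_cases h' : σ.label x' w = 0
        · have h := σ.label_eq_zero_mono hne hside h'
          have e2 := j'.1 h'
          have e3 := j.1 h
          calc ‖f w‖ * ‖g x' w‖ * ‖1 - g x w‖ ≤ 1 * (1 / 20) * (1 + 1 / 20) := by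
                gcongr; linarith
            _ ≤ 1 / 4 := by norm_num
        · have h : σ.label x w ≠ 0 := fun h => hcase ⟨h', h⟩
          have e2 := j'.2 h'
          have e3 := j.2 h
          have e4 : ‖g x' w‖ ≤ 21 / 20 := by
            have := norm_add_le (g x' w - 1) 1
            simp only [sub_add_cancel, norm_one] at this
            linarith
          rw [norm_sub_rev 1]
          calc ‖f w‖ * ‖g x' w‖ * ‖g x w - 1‖ ≤ 1 * (21 / 20) * (1 / 20) := by gcongr
            _ ≤ 1 / 4 := by norm_num
      · have e1 := hfε w ⟨hw, hwU⟩
        calc ‖f w‖ * ‖g x' w‖ * ‖1 - g x w‖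
            ≤ 1 / (4 * (M + 1) ^ 2) * (M + 1) * (M + 1) := by
              gcongr
              · linarith [bx' w]
              · linarith [bx w]
          _ = 1 / 4 := by field_simp
  refine ⟨f * g x' * (1 - g x), A.mul_mem (A.mul_mem hf (hgA x' hxT'))
    (A.sub_mem A.one_mem (hgA x hxT)), fun w hw => ?_, ?_, ?_⟩
  · by_cases h : σ.label x' w ≠ 0 ∧ σ.label x w = 0
    · exact Or.inr ((key w hw).1 h.1 h.2)
    · exact Or.inl ((key w hw).2 h)
  · obtain ⟨z, hz, -, hz0⟩ := hxT'.1
    exact ⟨z, hz, (key z hz).2 fun h => h.1 hz0⟩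
  · obtain ⟨z, hz, hzx, hz0⟩ := hxT'.2
    exact ⟨z, hz, (key z hz).1 hz0 (by rw [σ.label_eq x z (by rwa [hzx]), hzx, hside])⟩

theorem hasCSWP (σ : SplitMap X) : HasCSWP X :=
  hasCSWP_of_gapFunction fun _ _ hA hY hnt hpeak => σ.hasGapFunction hA hY hnt hpeak

/-- A Cantor set has countably many clopen subsets, but the cuts `label x = 0` at its uncountably
many two-sided points are distinct. -/
theorem not_hasCantorSubset (σ : SplitMap X) : ¬ HasCantorSubset X := by
  rintro ⟨C, ⟨e⟩⟩
  have hCc : CompactSpace C := e.symm.compactSpace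
  have hC : IsClosed C := (isCompact_iff_compactSpace.2 hCc).isClosed
  have : SecondCountableTopology C := e.isEmbedding.secondCountableTopology
  have : TotallyDisconnectedSpace C := e.symm.totallyDisconnectedSpace
  have hclop : Countable (TopologicalSpace.Clopens C) :=
    TopologicalSpace.Clopens.countable_iff_secondCountable.2 inferInstance
  have hunc : ¬ C.Countable := fun h => by
    have : Countable C := h.to_subtype
    exact not_countable_nat_bool e.symm.injective.countable
  have hT : ¬ (σ.twoSided C).Countable := fun h => hunc <| σ.countable_of_proj <|
    ((σ.countable_diff_twoSided hC).union h).mono fun x hx => by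
      by_cases hx' : x ∈ σ.twoSided C
      · exact Or.inr hx'
      · exact Or.inl ⟨hx, hx'⟩
  apply hT
  let φ : (ℕ → Bool) → TopologicalSpace.Clopens C := fun x =>
    ⟨Subtype.val ⁻¹' (σ.label x ⁻¹' {0}), (σ.isClopen_label x {0}).preimage continuous_subtype_val⟩
  have hφ : ∀ x z (hz : z ∈ C), (⟨z, hz⟩ : C) ∈ φ x ↔ σ.label x z = 0 := fun x z hz => Iff.rfl
  refine Set.MapsTo.countable_of_injOn (mapsTo_univ φ _) ?_ countable_univ
  have key : ∀ x ∈ σ.twoSided C, ∀ y ∈ σ.twoSided C, x ≠ y → side x y = 0 → φ x ≠ φ y := by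
    intro x hx y hy hne hside heq
    obtain ⟨z, hz, hzy, hz0⟩ := hy.2
    refine hz0 ((hφ y z hz).1 (heq ▸ (hφ x z hz).2 ?_))
    rw [σ.label_eq x z (by rwa [hzy]), hzy, hside]
  intro x hx y hy heq
  by_contra hne
  by_cases h : side x y = 0
  · exact key x hx y hy hne h heq
  · exact key y hy x hx (Ne.symm hne) ((side_comm_eq_zero_iff (Ne.symm hne)).2 h) heq.symm

end SplitMap

/-! ### Niceness. -/

namespace SplitMap

open PiNat

variable {X : Type u} [TopologicalSpace X] [CompactSpace X]

/-- A continuous function oscillates substantially on finitely many fibres only. -/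
theorem finite_setOf_oscillation (σ : SplitMap X) (f : C(X, ℂ)) {ε : ℝ} (hε : 0 < ε) :
    {x | ∃ z w, σ.proj z = x ∧ σ.proj w = x ∧ ε ≤ ‖f z - f w‖}.Finite := by
  have hloc : ∀ x : ℕ → Bool, ∃ n, ∀ y ∈ cylinder x n, y ≠ x →
      y ∉ {x | ∃ z w, σ.proj z = x ∧ σ.proj w = x ∧ ε ≤ ‖f z - f w‖} := by
    intro x
    obtain ⟨n, hn⟩ := σ.exists_cylinder_subset (x := x)
      (O := ⋃ z ∈ {z | σ.proj z = x}, σ.label x ⁻¹' {σ.label x z} ∩ {w | ‖f w - f z‖ < ε / 2})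
      (isOpen_biUnion fun z _ => (σ.isClopen_label x _).isOpen.inter
        (isOpen_lt ((f.continuous.sub continuous_const).norm) continuous_const))
      (fun z hz => mem_iUnion₂.2 ⟨z, hz, rfl, by simpa using half_pos hε⟩)
    refine ⟨n, ?_⟩
    rintro y hy hne ⟨z, w, hz, hw, hzw⟩
    obtain ⟨p, hp, hpz, hzp⟩ := mem_iUnion₂.1 (hn z (hz ▸ hy))
    obtain ⟨q, hq, hqw, hwq⟩ := mem_iUnion₂.1 (hn w (hw ▸ hy))
    -- All points over `y ≠ x` carry the same label `side x y` relative to `x`, so they are compared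
    -- with one and the same point over `x`.
    have hpq : p = q := by
      refine σ.ext p q (Eq.trans hp (Eq.symm hq)) ?_
      have h1 : σ.label x z = σ.label x p := hpz
      have h2 : σ.label x w = σ.label x q := hqw
      rw [show σ.proj p = x from hp, ← h1, ← h2, σ.label_eq x z (by rw [hz]; exact hne.symm),
        σ.label_eq x w (by rw [hw]; exact hne.symm), hz, hw]
    subst hpq
    have h1 : ‖f z - f p‖ < ε / 2 := hzp
    have h2 : ‖f w - f p‖ < ε / 2 := hwq
    have h3 := norm_sub_le (f z - f p) (f w - f p)
    rw [sub_sub_sub_cancel_right] at h3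
    linarith
  choose n hn using hloc
  obtain ⟨t, -, ht⟩ := (isCompact_univ (X := ℕ → Bool)).elim_nhds_subcover
    (fun x => cylinder x (n x))
    fun x _ => (_root_.isClopen_cylinder x (n x)).isOpen.mem_nhds (self_mem_cylinder _ _)
  refine t.finite_toSet.subset fun y hy => ?_
  obtain ⟨x, hx, hyx⟩ := mem_iUnion₂.1 (ht (mem_univ y))
  by_contra hyt
  exact hn x y hyx (fun h => hyt (h ▸ hx)) hy

/-- The coordinates of the projection serve as the family; its classes are the finite fibres. -/
theorem isNiceSpace [T2Space X] (σ : SplitMap X) : IsNiceSpace X := by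
  let e : ℕ → C(X, ℂ) := fun n => ⟨fun z => if σ.proj z n then 1 else 0,
    (continuous_of_discreteTopology (f := fun b : Bool => if b then (1 : ℂ) else 0)).comp
      ((continuous_apply n).comp σ.continuous_proj)⟩
  have hr : ∀ z w, (evalSetoid (range e)) z w ↔ σ.proj z = σ.proj w := by
    intro z w
    constructor
    · intro h
      funext n
      have h' : (if σ.proj z n then (1 : ℂ) else 0) = if σ.proj w n then 1 else 0 :=
        h (e n) ⟨n, rfl⟩
      revert h'
      cases σ.proj z n <;> cases σ.proj w n <;> simp
    · rintro h _ ⟨n, rfl⟩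
      change (if σ.proj z n then (1 : ℂ) else 0) = if σ.proj w n then 1 else 0
      rw [h]
  have hclass : ∀ c ∈ (evalSetoid (range e)).classes, ∃ z, c = {w | σ.proj w = σ.proj z} := by
    rintro c ⟨z, rfl⟩
    exact ⟨z, Set.ext fun w => hr w z⟩
  refine ⟨range e, countable_range e, ?_, fun f => ?_⟩
  · intro c hc T hT hne
    obtain ⟨z, rfl⟩ := hclass c hc
    obtain ⟨p, V, hV, hVT⟩ := exists_isolated_of_finite (Y := T) isOpen_univ (by simpa using hne)
      (by simpa using (σ.finite_fibre (σ.proj z)).subset hT)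
    exact ⟨p, (hVT.ge rfl).2, V, hV, hVT⟩
  · have hc : (⋃ n : ℕ, {x | ∃ z w, σ.proj z = x ∧ σ.proj w = x ∧
        1 / ((n : ℝ) + 1) ≤ ‖f z - f w‖}).Countable :=
      countable_iUnion fun n => (σ.finite_setOf_oscillation f (by positivity)).countable
    refine (hc.image fun x => {z | σ.proj z = x}).mono ?_
    rintro c ⟨hcc, hcf⟩
    obtain ⟨z, rfl⟩ := hclass c hcc
    refine ⟨σ.proj z, ?_, rfl⟩
    obtain ⟨w, hw, hne⟩ : ∃ w, σ.proj w = σ.proj z ∧ f w ≠ f z := by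
      by_contra hcon
      push Not at hcon
      refine hcf ⟨f z, eq_singleton_iff_unique_mem.2 ⟨⟨z, rfl, rfl⟩, ?_⟩⟩
      rintro _ ⟨w, hw, rfl⟩
      exact hcon w hw
    obtain ⟨n, hn⟩ := exists_nat_one_div_lt (norm_pos_iff.2 (sub_ne_zero.2 hne))
    exact mem_iUnion.2 ⟨n, w, z, hw, rfl, hn.le⟩

end SplitMap

/-! ### The separable split space and its discrete subsets. -/

section Construction

open PiNat

/-- The Cantor set with all points split, as a subset of a product of compact spaces. -/
def splitSet : Set ((ℕ → Bool) × ((ℕ → Bool) → Fin 3)) :=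
  {p | ∀ x, x ≠ p.1 → p.2 x = side x p.1}

theorem isClosed_splitSet : IsClosed splitSet := by
  rw [← isOpen_compl_iff, isOpen_iff_mem_nhds]
  intro p hp
  simp only [splitSet, mem_compl_iff, mem_ofPred_eq, not_forall] at hp
  obtain ⟨x, hx, hne⟩ := hp
  have h1 : Prod.fst ⁻¹' cylinder p.1 (firstDiff x p.1 + 1) ∈ 𝓝 p :=
    continuous_fst.continuousAt ((isClopen_cylinder _ _).isOpen.mem_nhds (self_mem_cylinder _ _))
  have h2 : (fun q : (ℕ → Bool) × ((ℕ → Bool) → Fin 3) => q.2 x) ⁻¹' {p.2 x} ∈ 𝓝 p :=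
    ((continuous_apply x).comp continuous_snd).continuousAt ((isOpen_discrete _).mem_nhds rfl)
  filter_upwards [h1, h2] with q hq1 hq2 hq
  obtain ⟨h3, h4⟩ := side_congr_right hx hq1
  have h5 : q.2 x = p.2 x := hq2
  exact hne (by rw [← h5, ← h4, hq x h3])

instance : CompactSpace splitSet := isCompact_iff_compactSpace.1 isClosed_splitSet.isCompact

/-- The tautological splitting of `splitSet`. -/
def splitSetMap : SplitMap splitSet where
  proj p := p.1.1
  label x p := p.1.2 x
  continuous_proj := continuous_fst.comp continuous_subtype_val
  continuous_label x := (continuous_apply x).comp (continuous_snd.comp continuous_subtype_val)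
  label_eq x p h := p.2 x h
  ext p q h h' := by
    refine Subtype.ext (Prod.ext h (funext fun x => ?_))
    by_cases hx : x = p.1.1
    · rw [hx]; exact h'
    · rw [p.2 x hx, q.2 x (h ▸ hx), h]

open Classical in
/-- The point over `y` with label `i`. -/
noncomputable def splitPoint (y : ℕ → Bool) (i : Fin 3) : splitSet :=
  ⟨(y, fun x => if x = y then i else side x y), fun _ hx => if_neg hx⟩

theorem proj_splitPoint (y : ℕ → Bool) (i : Fin 3) : splitSetMap.proj (splitPoint y i) = y := rfl

theorem label_splitPoint_self (y : ℕ → Bool) (i : Fin 3) :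
    splitSetMap.label y (splitPoint y i) = i := if_pos rfl

theorem label_splitPoint {x y : ℕ → Bool} (h : x ≠ y) (i : Fin 3) :
    splitSetMap.label x (splitPoint y i) = side x y := if_neg h

/-- The extension of a finite sequence by the constant `true`. -/
def extendTrue (s : Σ n, Fin n → Bool) : ℕ → Bool :=
  fun k => if h : k < s.1 then s.2 ⟨k, h⟩ else true

theorem extendTrue_of_le {s : Σ n, Fin n → Bool} {k : ℕ} (h : s.1 ≤ k) : extendTrue s k = true :=
  dif_neg h.not_gt

/-- The eventually true sequences, approached from the left. -/
def splitSeq : Set splitSet := range fun s => splitPoint (extendTrue s) 0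

theorem splitPoint_two_mem_closure {x : ℕ → Bool} {N : ℕ}
    (h : ∀ m ≥ N, ¬ Even m → x m = false) : splitPoint x 2 ∈ closure splitSeq := by
  rw [mem_closure_iff]
  intro O hO hx
  obtain ⟨n, hn⟩ := splitSetMap.exists_cylinder_label_subset hO hx
  simp only [proj_splitPoint, label_splitPoint_self] at hn
  -- At this odd index, beyond `n` and `N`, `x` is false; switching to true there moves right with
  -- odd first difference, hence label 2.
  set m := 2 * (n + N) + 1 with hm
  have hodd : ¬ Even m := by simp [hm, parity_simps]
  set q := extendTrue ⟨m, fun i => x i⟩ with hq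
  have hag : ∀ k < m, x k = q k := fun k hk => by simp [hq, extendTrue, hk]
  have hxm : x m = false := h m (by omega) hodd
  have hqm : q m = true := extendTrue_of_le le_rfl
  have hne : x ≠ q := fun e => by rw [e, hqm] at hxm; cases hxm
  refine ⟨splitPoint q 0, hn _ (fun k hk => (hag k (by omega)).symm) ?_, ⟨_, rfl⟩⟩
  rw [label_splitPoint hne, side_eq hag (by rw [hxm, hqm]; decide), hxm]
  simp [hodd]

/-- The family of sequences which start like `q`, then deviate to the left of it at `2 * N`, and
whose later odd entries vanish. -/
def branch (q : ℕ → Bool) (N : ℕ) (b : ℕ → Bool) : ℕ → Bool := fun k =>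
  -- Position 2 (N + 1 + j) carries `b j`.
  if k < 2 * N then q k else if Even k ∧ k ≠ 2 * N then b (k / 2 - N - 1) else false

theorem branch_of_lt {q b : ℕ → Bool} {N k : ℕ} (h : k < 2 * N) : branch q N b k = q k := if_pos h

theorem branch_two_mul (q b : ℕ → Bool) (N : ℕ) : branch q N b (2 * N) = false := by
  simp [branch]

theorem branch_odd {q b : ℕ → Bool} {N k : ℕ} (h : 2 * N ≤ k) (hk : ¬ Even k) :
    branch q N b k = false := by
  simp [branch, hk, h.not_gt]

theorem branch_injective (q : ℕ → Bool) (N : ℕ) : Function.Injective (branch q N) := by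
  intro b c h
  funext j
  have h' := congrFun h (2 * (N + 1 + j))
  have e : 2 * (N + 1 + j) / 2 - N - 1 = j := by omega
  have h1 : ¬ 2 * (N + 1 + j) < 2 * N := by omega
  have h2 : 2 * (N + 1 + j) ≠ 2 * N := by omega
  simpa only [branch, if_neg h1, even_two_mul, true_and, if_pos h2, e] using h'

theorem even_firstDiff_branch {q b c : ℕ → Bool} {N : ℕ} (h : branch q N b ≠ branch q N c) :
    Even (firstDiff (branch q N b) (branch q N c)) := by
  have h' := apply_firstDiff_ne h
  by_contra hodd
  rcases lt_or_ge (firstDiff (branch q N b) (branch q N c)) (2 * N) with hlt | hle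
  · rw [branch_of_lt hlt, branch_of_lt hlt] at h'
    exact h' rfl
  · rw [branch_odd hle hodd, branch_odd hle hodd] at h'
    exact h' rfl

/-- A compact separable space: the closure of `splitSeq`. -/
abbrev SplitCantor : Type := closure splitSeq

instance : CompactSpace SplitCantor := isCompact_iff_compactSpace.1 isClosed_closure.isCompact

instance : TopologicalSpace.SeparableSpace SplitCantor := by
  refine ⟨Subtype.val ⁻¹' splitSeq, (countable_range _).preimage Subtype.val_injective, ?_⟩
  rw [Subtype.dense_iff, Subtype.image_preimage_coe]
  exact closure_mono fun z hz => ⟨subset_closure hz, hz⟩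

instance : Nonempty SplitCantor :=
  ⟨⟨splitPoint (extendTrue ⟨0, fun _ => true⟩) 0, subset_closure ⟨_, rfl⟩⟩⟩

/-- Every non-empty open subset of `SplitCantor` has an uncountable discrete subset. -/
theorem SplitCantor.exists_uncountable_discrete {W : Set SplitCantor} (hW : IsOpen W)
    (hne : W.Nonempty) : ∃ D ⊆ W, ¬ D.Countable ∧
      ∀ d ∈ D, ∃ U : Set SplitCantor, IsOpen U ∧ U ∩ D = {d} := by
  obtain ⟨O, hO, rfl⟩ := isOpen_induced_iff.1 hW
  obtain ⟨⟨z, hz⟩, hzO⟩ := hne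
  obtain ⟨_, hsO, ⟨s, rfl⟩⟩ := mem_closure_iff.1 hz O hO hzO
  obtain ⟨n, hn⟩ := splitSetMap.exists_cylinder_label_subset hO hsO
  set q := extendTrue s with hq
  simp only [proj_splitPoint, label_splitPoint_self] at hn
  -- Index `2 * N` is past the cylinder length and past the prefix `s`, so `q` is true there and can
  -- be left towards the left, the side that a point of label 0 requires.
  set N := n + s.1 with hN
  have hqN : q (2 * N) = true := extendTrue_of_le (by omega)
  let x : (ℕ → Bool) → ℕ → Bool := branch q N
  have hag : ∀ b, ∀ k < 2 * N, q k = x b k := fun b k hk => (branch_of_lt hk).symm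
  have hxN : ∀ b, x b (2 * N) = false := fun b => branch_two_mul q b N
  let p : (ℕ → Bool) → SplitCantor := fun b =>
    ⟨splitPoint (x b) 2, splitPoint_two_mem_closure fun m hm hodd => branch_odd hm hodd⟩
  have hp : Function.Injective p := fun b c h =>
    branch_injective q N (congrArg (fun z : SplitCantor => splitSetMap.proj z) h)
  refine ⟨range p, ?_, ?_, ?_⟩
  · rintro _ ⟨b, rfl⟩
    have hne : q ≠ x b := fun e => by
      have := congrFun e (2 * N)
      rw [hqN, hxN] at this
      cases this
    refine hn _ (fun k hk => (hag b k (by omega)).symm) ?_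
    rw [label_splitPoint hne, side_eq_zero_of (hag b) hqN (hxN b)]
  · intro hc
    have : Countable (range p) := hc.to_subtype
    exact not_countable_nat_bool (rangeFactorization_injective.2 hp).countable
  · rintro _ ⟨b, rfl⟩
    -- Other branches first differ from `x b` at an even index, so they have label 0 or 1 relative
    -- to it.
    refine ⟨Subtype.val ⁻¹' (splitSetMap.label (x b) ⁻¹' {2}),
      (splitSetMap.isClopen_label (x b) {2}).isOpen.preimage continuous_subtype_val, ?_⟩
    ext z
    constructor
    · rintro ⟨hz, c, rfl⟩
      by_contra hcb
      have hne : x b ≠ x c := fun e => hcb (by rw [branch_injective q N e]; rfl)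
      have h2 : side (x b) (x c) = 2 := by rw [← label_splitPoint hne 2]; exact hz
      rw [side, if_pos (even_firstDiff_branch hne)] at h2
      split_ifs at h2 <;> simp at h2
    · rintro rfl
      exact ⟨label_splitPoint_self (x b) 2, b, rfl⟩

end Construction

/-! ### Conclusion. -/

theorem separableSpace_of_open_subset {X : Type u} [TopologicalSpace X]
    [TopologicalSpace.SeparableSpace X] {U S : Set X} (hU : IsOpen U) (hUS : U ⊆ S)
    (hSU : S ⊆ closure U) : TopologicalSpace.SeparableSpace S := by
  obtain ⟨Q, hQ, hd⟩ := TopologicalSpace.exists_countable_dense X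
  refine ⟨Subtype.val ⁻¹' (U ∩ Q), (hQ.mono inter_subset_right).preimage Subtype.val_injective, ?_⟩
  rw [Subtype.dense_iff, Subtype.image_preimage_coe,
    inter_eq_right.2 (inter_subset_left.trans hUS)]
  exact hSU.trans (closure_minimal (hd.open_subset_closure_inter hU) isClosed_closure)

theorem mainTheorem10 :
    ∃ (Z : Type) (_ : TopologicalSpace Z),
      Nonempty Z ∧ CompactSpace Z ∧ T2Space Z ∧ TopologicalSpace.SeparableSpace Z ∧
      IsNiceSpace Z ∧
      ¬ HasCantorSubset Z ∧
      (∀ W : Set Z, IsOpen W → W.Nonempty → ¬ IsLOTS W) ∧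
      HasCSWP Z ∧
      ¬ IsLPRScattered Z := by
  let σ : SplitMap SplitCantor := splitSetMap.restrict _
  refine ⟨SplitCantor, inferInstance, inferInstance, inferInstance, inferInstance, inferInstance,
    σ.isNiceSpace, σ.not_hasCantorSubset, fun W hW hne hlots => ?_, σ.hasCSWP, fun hscat => ?_⟩
  · obtain ⟨D, hDW, hunc, hdisc⟩ := SplitCantor.exists_uncountable_discrete hW hne
    have := separableSpace_of_open_subset hW subset_rfl subset_closure
    exact hunc (countable_of_preimage_val hDW
      (hlots.countable_of_discrete (isOpen_inter_preimage_val_eq_singleton hdisc)))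
  -- The whole space already violates LPR-scatteredness: the closure of a non-empty open set is
  -- separable and contains an uncountable discrete set.
  · obtain ⟨U, -, hne, ⟨V, hV, rfl⟩, hlpr⟩ := hscat univ isClosed_univ univ_nonempty
    rw [inter_univ] at hne hlpr
    obtain ⟨D, hDV, hunc, hdisc⟩ := SplitCantor.exists_uncountable_discrete hV hne
    have := separableSpace_of_open_subset hV subset_closure subset_rfl
    exact hunc (countable_of_preimage_val (hDV.trans subset_closure)
      (hlpr.countable_of_discrete (isOpen_inter_preimage_val_eq_singleton hdisc)))
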